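/- There is an absolute constant $K>0$ such that for every $n\ge 1$, every unitary $U\in\mathbb{C}^{2^n\times 2^n}$ acting on $n$ qubits and every $0<\varepsilon\le 1$ there are an integer $0\le a\le 2$ and a circuit $c$ on $n+a$ qubits, composed of Hadamard, phase $\mathrm{diag}(1,i)$, CNOT and $T=\mathrm{diag}(1,e^{i\pi/4})$ gates, that has at most $$K\,4^{n}\,n\,\bigl(\log(1/\varepsilon)+n\bigr)$$ gates and approximates $U$ within Frobenius distance $\varepsilon$ using $a$ ancillae that start in the state $|0\rangle$ and are to be returned to it: if $V_c$ is the unitary on $n+a$ qubits computed by $c$, then $$\bigl\|V_c\,(I\otimes|0^a\rangle)-U\otimes|0^a\rangle\bigr\|_{F}\le\varepsilon ,\qquad \|A\|_F^2=\mathrm{Tr}(AA^\dagger).$$ -/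

import Mathlib

open scoped Matrix

/-- Computational basis states of a register of qubits whose wires are labelled by `ι`: one bit
for each wire. Operators on the register are complex matrices indexed by these basis states. -/
abbrev BasisState (ι : Type) : Type := ι → Fin 2

/-- The Hadamard matrix. -/
noncomputable def hadamardMatrix : Matrix (Fin 2) (Fin 2) ℂ :=
  ((1 / Real.sqrt 2 : ℝ) : ℂ) • !![1, 1; 1, -1]

/-- The phase matrix `S = diag(1, i)`. -/
noncomputable def phaseMatrix : Matrix (Fin 2) (Fin 2) ℂ :=
  !![1, 0; 0, Complex.I]

/-- The matrix `T = diag(1, e^{iπ/4})`. -/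
noncomputable def tMatrix : Matrix (Fin 2) (Fin 2) ℂ :=
  !![1, 0; 0, Complex.exp (Complex.I * Real.pi / 4)]

/-- The one-qubit operator `M` on the wire `q`, tensored with the identity on all other wires. -/
def onQubit {ι : Type} [Fintype ι] [DecidableEq ι] (q : ι) (M : Matrix (Fin 2) (Fin 2) ℂ) :
    Matrix (BasisState ι) (BasisState ι) ℂ :=
  Matrix.of fun x y => if ∀ j, j ≠ q → x j = y j then M (x q) (y q) else 0

/-- The controlled-NOT operator with control wire `c` and target wire `t`: it maps the basis state
`y` to the basis state in which the bit at `t` is replaced by `y t + y c` modulo 2. -/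
def cnotMatrix {ι : Type} [Fintype ι] [DecidableEq ι] (c t : ι) :
    Matrix (BasisState ι) (BasisState ι) ℂ :=
  Matrix.of fun x y => if x = Function.update y t (y t + y c) then 1 else 0

/-- The elementary Clifford and T gates on a register with wires `ι`. -/
inductive CliffordTGate (ι : Type) : Type
  | hadamard (q : ι) : CliffordTGate ι
  | phase (q : ι) : CliffordTGate ι
  | tGate (q : ι) : CliffordTGate ι
  | cnot (c t : ι) (h : c ≠ t) : CliffordTGate ι

/-- The operator of a gate. -/
noncomputable def CliffordTGate.toMatrix {ι : Type} [Fintype ι] [DecidableEq ι] :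
    CliffordTGate ι → Matrix (BasisState ι) (BasisState ι) ℂ
  | .hadamard q => onQubit q hadamardMatrix
  | .phase q => onQubit q phaseMatrix
  | .tGate q => onQubit q tMatrix
  | .cnot c t _h => cnotMatrix c t

/-- A Clifford+T circuit is a finite sequence of gates; its number of gates is its length. -/
abbrev CliffordTCircuit (ι : Type) : Type := List (CliffordTGate ι)

/-- The operator of a circuit; the first gate of the list is applied first. -/
noncomputable def circuitMatrix {ι : Type} [Fintype ι] [DecidableEq ι] :
    CliffordTCircuit ι → Matrix (BasisState ι) (BasisState ι) ℂ
  | [] => 1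
  | g :: gs => circuitMatrix gs * g.toMatrix

/-- The isometry `|φ⟩ ↦ |φ⟩ ⊗ |0…0⟩` that adjoins `a` ancillary qubits in the state `|0⟩` to
`n` data qubits. -/
def addAncillae (n a : ℕ) :
    Matrix (BasisState (Fin n ⊕ Fin a)) (BasisState (Fin n)) ℂ :=
  Matrix.of fun x y => if x = Sum.elim y (fun _ => 0) then 1 else 0

/-- The Frobenius distance `√(Tr((A - B)(A - B)†))`, taken from the Frobenius norm on matrices. -/
noncomputable def frobeniusDist {l m : Type} [Fintype l] [Fintype m] (A B : Matrix l m ℂ) : ℝ :=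
  letI : NormedAddCommGroup (Matrix l m ℂ) := Matrix.frobeniusNormedAddCommGroup
  ‖A - B‖

/-- The circuit `c` on `n` data qubits and `a` ancillae approximates the `n`-qubit operator `U`
within Frobenius distance `ε`: started with all ancillae in `|0⟩`, it realizes the map
`|φ⟩ ⊗ |0…0⟩ ↦ U|φ⟩ ⊗ |0…0⟩` up to `ε`. -/
def ApproximatesWithin {n a : ℕ} (c : CliffordTCircuit (Fin n ⊕ Fin a))
    (U : Matrix (BasisState (Fin n)) (BasisState (Fin n)) ℂ) (ε : ℝ) : Prop :=
  frobeniusDist (circuitMatrix c * addAncillae n a) (addAncillae n a * U) ≤ ε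

set_option linter.unusedSectionVars false

/-! The first ancilla selects between `U` and the identity, which gives a unitary `extendUnitary U`
of size `2 * 2 ^ n` with half of its columns already basis vectors. The other columns are cleared in
Householder fashion (`exists_reflections_reduce`): at most three reflections turn each one into a
basis vector and push its phase onto one spare basis state `f`, whose first ancilla bit is 1. Inputs
have that bit 0, so the leftover phase is never seen. Thus `U` is obtained from at most `3 * 2 ^ n`
reflections, each in a unit vector with two zero entries.

The zero entries allow rounding without loss of norm (`exists_gaussian_approx`). After scaling by `2
^ K`, coordinates are truncated towards zero; the missing squared norm is a nonnegative integer,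
hence a sum of four squares, and these fill the real and imaginary parts of the two zero entries.
The squared error is of order `2 ^ n / 2 ^ K`.

A reflection in a unit vector of Gaussian integers over `√2 ^ k` is synthesized exactly
(`implClean_reflectionMatrix`). A circuit `W` lowers the denominator exponent one unit at a time
(`exists_reduce_entries`), using phases on single basis states and Hadamards on pairs of them, until
one entry is left; the reflection is `Wᴴ`, a sign flip on one basis state, `W`. Each such elementary
operation costs `O(n)` gates: multiply controlled NOTs borrow idle wires (`impl_mcx`), and the
second ancilla, in state 0, receives the phase (`impl_phase_gadget`).

The count is `3 * 2 ^ n` reflections, times `O(K)` rounds, times `O(2 ^ n)` elementary operations,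
times `O(n)` gates; `K = O(n + log (1 / ε))` makes the accumulated error at most `ε`. -/

/-- The 0-1 matrix of a self-map of the index type. -/
def funMatrix {α : Type} [DecidableEq α] (φ : α → α) : Matrix α α ℂ :=
  Matrix.of fun x y => if x = φ y then 1 else 0

/-! ### Permutation matrices of basis states. -/

section FunMatrix
variable {α : Type} [Fintype α] [DecidableEq α]

lemma funMatrix_mul (φ ψ : α → α) : funMatrix φ * funMatrix ψ = funMatrix (φ ∘ ψ) := by
  ext x y
  simp [funMatrix, Matrix.mul_apply]

lemma funMatrix_id : funMatrix (id : α → α) = 1 := by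
  ext x y
  simp [funMatrix, Matrix.one_apply]

lemma funMatrix_conjTranspose {φ ψ : α → α} (h₁ : ∀ x, φ (ψ x) = x) (h₂ : ∀ x, ψ (φ x) = x) :
    (funMatrix φ)ᴴ = funMatrix ψ := by
  ext x y
  have : y = φ x ↔ x = ψ y := ⟨fun h => by rw [h, h₂], fun h => by rw [h, h₁]⟩
  simp only [funMatrix, Matrix.conjTranspose_apply, Matrix.of_apply, this]
  split_ifs <;> simp

lemma funMatrix_mulVec {φ ψ : α → α} (h₁ : ∀ x, φ (ψ x) = x) (h₂ : ∀ x, ψ (φ x) = x)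
    (v : α → ℂ) (x : α) : (funMatrix φ *ᵥ v) x = v (ψ x) := by
  have : ∀ y, x = φ y ↔ y = ψ x :=
    fun y => ⟨fun h => by rw [h, h₂], fun h => by rw [h, h₁]⟩
  simp [funMatrix, Matrix.mulVec, dotProduct, this]

lemma funMatrix_conj_diagonal {φ : α → α} (h : ∀ x, φ (φ x) = x) (g : α → ℂ) :
    funMatrix φ * Matrix.diagonal g * funMatrix φ = Matrix.diagonal (g ∘ φ) := by
  ext x y
  rw [Matrix.mul_apply]
  simp only [Matrix.mul_diagonal, Matrix.diagonal_apply, funMatrix, Matrix.of_apply,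
    mul_ite, mul_one, mul_zero, Finset.sum_ite_eq', Finset.mem_univ, if_true, h, ite_mul, one_mul,
    zero_mul, Function.comp]
  split_ifs with h1
  · rw [h1]
  · rfl

end FunMatrix

/-! ### Controlled one-qubit operators and multiply controlled NOTs. -/

section Ctrl
variable {κ : Type} [Fintype κ] [DecidableEq κ]

/-- A one-qubit operator on the wire `q` that may depend on the other wires. -/
def ctrl (q : κ) (f : BasisState κ → Matrix (Fin 2) (Fin 2) ℂ) :
    Matrix (BasisState κ) (BasisState κ) ℂ :=
  Matrix.of fun x y => if ∀ j, j ≠ q → x j = y j then f x (x q) (y q) else 0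

lemma onQubit_eq_ctrl (q : κ) (M : Matrix (Fin 2) (Fin 2) ℂ) : onQubit q M = ctrl q fun _ => M :=
  rfl

lemma agree_off_iff (q : κ) (x y : BasisState κ) :
    (∀ j, j ≠ q → x j = y j) ↔ x = Function.update y q (x q) := by
  constructor
  · intro h
    ext j
    by_cases hj : j = q
    · subst hj; simp
    · simp [hj, h j hj]
  · intro h j hj
    rw [h]; simp [hj]

/-- The intermediate state may differ from `x` at `q` only, so the sum has two terms. `g` is
evaluated at that state, hence the requirement that it ignore `q`. -/
lemma ctrl_mul (q : κ) (f g : BasisState κ → Matrix (Fin 2) (Fin 2) ℂ)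
    (hg : ∀ x b, g (Function.update x q b) = g x) :
    ctrl q f * ctrl q g = ctrl q fun x => f x * g x := by
  ext x y
  rw [Matrix.mul_apply]
  rw [← Fintype.sum_of_injective (fun b : Fin 2 => Function.update x q b)
    (Function.update_injective x q)
    (fun b => if ∀ j, j ≠ q → x j = y j then f x (x q) b * g x b (y q) else 0)]
  · by_cases h : ∀ j, j ≠ q → x j = y j
    · simp [ctrl, Matrix.mul_apply]
    · simp [ctrl, h]
  · intro z hz
    have : ¬ ∀ j, j ≠ q → x j = z j := by
      intro h
      refine hz ⟨z q, ?_⟩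
      exact ((agree_off_iff q z x).1 fun j hj => (h j hj).symm).symm
    simp only [ctrl, Matrix.of_apply, if_neg this, zero_mul]
  · intro b
    have h1 : ∀ j, j ≠ q → x j = Function.update x q b j := by
      intro j hj; simp [hj]
    have h2 : (∀ j, j ≠ q → Function.update x q b j = y j) ↔ ∀ j, j ≠ q → x j = y j := by
      refine forall_congr' fun j => forall_congr' fun hj => by simp [hj]
    simp only [ctrl, Matrix.of_apply, if_pos h1, h2, Function.update_self, hg]
    split_ifs <;> simp

lemma ctrl_one (q : κ) : ctrl q (fun _ => 1) = 1 := by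
  ext x y
  simp only [ctrl, Matrix.of_apply, Matrix.one_apply]
  by_cases h : x = y
  · simp [h]
  · rw [if_neg h]
    split_ifs with h1 h2
    · exact absurd (by ext j; by_cases hj : j = q; · rw [hj, h2]
                       · rw [h1 j hj]) h
    · rfl
    · rfl

lemma onQubit_mul (q : κ) (M N : Matrix (Fin 2) (Fin 2) ℂ) :
    onQubit q M * onQubit q N = onQubit q (M * N) := by
  simp only [onQubit_eq_ctrl]
  rw [ctrl_mul q _ _ fun _ _ => rfl]

lemma onQubit_one (q : κ) : onQubit q 1 = 1 := ctrl_one q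

lemma onQubit_pow (q : κ) (M : Matrix (Fin 2) (Fin 2) ℂ) (k : ℕ) :
    onQubit q M ^ k = onQubit q (M ^ k) := by
  induction k with
  | zero => simp [onQubit_one]
  | succ k ih => rw [pow_succ, ih, onQubit_mul, pow_succ]

lemma onQubit_conjTranspose (q : κ) (M : Matrix (Fin 2) (Fin 2) ℂ) :
    (onQubit q M)ᴴ = onQubit q Mᴴ := by
  ext x y
  have : (∀ j, j ≠ q → y j = x j) ↔ ∀ j, j ≠ q → x j = y j := by
    simp only [eq_comm]
  simp only [onQubit, Matrix.conjTranspose_apply, Matrix.of_apply, this]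
  split_ifs <;> simp

lemma onQubit_diagonal (q : κ) (d : Fin 2 → ℂ) :
    onQubit q (Matrix.diagonal d) = Matrix.diagonal fun x => d (x q) := by
  ext x y
  simp only [onQubit, Matrix.of_apply, Matrix.diagonal_apply]
  by_cases h : x = y
  · simp [h]
  · rw [if_neg h]
    split_ifs with h1 h2
    · exact absurd (by ext j; by_cases hj : j = q; · rw [hj, h2]
                       · rw [h1 j hj]) h
    · rfl
    · rfl

lemma diagonal_eq_ctrl (q : κ) (g : BasisState κ → ℂ) :
    Matrix.diagonal g =
      ctrl q fun x => Matrix.diagonal fun b => g (Function.update x q b) := by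
  ext x y
  simp only [ctrl, Matrix.of_apply, Matrix.diagonal_apply, Function.update_eq_self]
  by_cases h : x = y
  · simp [h]
  · rw [if_neg h]
    split_ifs with h1 h2
    · exact absurd (by ext j; by_cases hj : j = q; · rw [hj, h2]
                       · rw [h1 j hj]) h
    · rfl
    · rfl

/-- The basis permutation that flips the wire `t` if all wires in `S` are on. -/
def flipIf (S : Finset κ) (t : κ) (y : BasisState κ) : BasisState κ :=
  Function.update y t (y t + if ∀ s ∈ S, y s = 1 then 1 else 0)

/-- The multiply controlled NOT with controls `S` and target `t`. -/
def mcx (S : Finset κ) (t : κ) : Matrix (BasisState κ) (BasisState κ) ℂ := funMatrix (flipIf S t)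

lemma flipIf_ne (S : Finset κ) {t j : κ} (h : j ≠ t) (y : BasisState κ) :
    flipIf S t y j = y j := by simp [flipIf, h]

lemma flipIf_self (S : Finset κ) (t : κ) (y : BasisState κ) :
    flipIf S t y t = y t + if ∀ s ∈ S, y s = 1 then 1 else 0 := by simp [flipIf]

lemma flipIf_cond {S A : Finset κ} {t : κ} (h : t ∉ A) (y : BasisState κ) :
    (∀ s ∈ A, flipIf S t y s = 1) ↔ ∀ s ∈ A, y s = 1 := by
  refine forall₂_congr fun s hs => ?_
  rw [flipIf_ne]
  rintro rfl; exact h hs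

lemma fin_two_add_self (a b : Fin 2) : a + b + b = a := by
  revert a b; decide

lemma fin_two_add_right_comm (a b c : Fin 2) : a + b + c = a + c + b := by
  revert a b c; decide

lemma flipIf_flipIf {S : Finset κ} {t : κ} (h : t ∉ S) (y : BasisState κ) :
    flipIf S t (flipIf S t y) = y := by
  ext j : 1
  by_cases hj : j = t
  · subst hj
    rw [flipIf_self, flipIf_self]
    simp only [flipIf_cond h, fin_two_add_self]
  · rw [flipIf_ne _ hj, flipIf_ne _ hj]

lemma mcx_mul_self {S : Finset κ} {t : κ} (h : t ∉ S) : mcx S t * mcx S t = 1 := by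
  rw [mcx, funMatrix_mul, ← funMatrix_id]
  congr 1
  ext1 y
  exact flipIf_flipIf h y

lemma mcx_conjTranspose {S : Finset κ} {t : κ} (h : t ∉ S) : (mcx S t)ᴴ = mcx S t :=
  funMatrix_conjTranspose (flipIf_flipIf h) (flipIf_flipIf h)

lemma cnotMatrix_eq_mcx (c t : κ) : cnotMatrix c t = mcx {c} t := by
  ext x y
  have : Function.update y t (y t + y c) = flipIf {c} t y := by
    simp only [flipIf, Finset.mem_singleton, forall_eq]
    congr 2
    generalize y c = b
    revert b; decide
  simp only [cnotMatrix, mcx, funMatrix, Matrix.of_apply, this]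

lemma mcx_comm {A B : Finset κ} {u v : κ} (hu : u ∉ B) (hv : v ∉ A) :
    mcx A u * mcx B v = mcx B v * mcx A u := by
  rw [mcx, mcx, funMatrix_mul, funMatrix_mul]
  congr 1
  ext1 y
  ext j : 1
  simp only [Function.comp]
  by_cases hj : j = u
  · subst hj
    rw [flipIf_self]
    simp only [flipIf_cond hv]
    by_cases hv' : j = v
    · subst hv'
      rw [flipIf_self, flipIf_self]
      simp only [flipIf_cond hu, flipIf_self]
      rw [fin_two_add_right_comm]
    · rw [flipIf_ne _ hv', flipIf_ne _ hv', flipIf_self]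
  · rw [flipIf_ne _ hj]
    by_cases hv' : j = v
    · subst hv'
      rw [flipIf_self, flipIf_self]
      simp only [flipIf_cond hu, flipIf_ne _ hj]
    · simp only [flipIf_ne _ hj, flipIf_ne _ hv']

/-- The matrix of the NOT gate. -/
def notMatrix : Matrix (Fin 2) (Fin 2) ℂ := !![0, 1; 1, 0]

lemma mcx_eq_ctrl {S : Finset κ} {t : κ} (h : t ∉ S) :
    mcx S t = ctrl t fun x => if ∀ s ∈ S, x s = 1 then notMatrix else 1 := by
  ext x y
  simp only [mcx, ctrl, funMatrix, Matrix.of_apply]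
  by_cases hxy : ∀ j, j ≠ t → x j = y j
  · rw [if_pos hxy]
    have hc : (∀ s ∈ S, y s = 1) ↔ ∀ s ∈ S, x s = 1 := by
      refine forall₂_congr fun s hs => ?_
      rw [hxy s]; rintro rfl; exact h hs
    have : x = flipIf S t y ↔ x t = y t + if ∀ s ∈ S, x s = 1 then 1 else 0 := by
      rw [← if_congr hc rfl rfl, ← flipIf_self]
      refine ⟨fun h => by rw [← h], fun h => ?_⟩
      ext j : 1
      by_cases hj : j = t
      · rw [hj, h]
      · rw [hxy j hj, flipIf_ne _ hj]
    rw [if_congr this rfl rfl]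
    generalize x t = a
    generalize y t = b
    split_ifs with h1 h2 <;> revert a b <;> simp [Fin.forall_fin_two, notMatrix]
  · rw [if_neg hxy, if_neg]
    rintro rfl
    exact hxy fun j hj => flipIf_ne _ hj y

/-- The target receives `x·d` and then `x·(d + ⋀S)`, in total `x·⋀S`: the value of `d` cancels, so
`d` can be borrowed in any state. The flip of `d` remains to be undone. -/
lemma mcx_insert_dirty {S : Finset κ} {x d t : κ} (hxd : x ≠ d) (hxt : x ≠ t) (hdt : d ≠ t)
    (hd : d ∉ S) (ht : t ∉ S) :
    mcx {x, d} t * mcx S d * mcx {x, d} t = mcx (insert x S) t * mcx S d := by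
  simp only [mcx, funMatrix_mul]
  congr 1
  ext1 y
  ext j : 1
  simp only [Function.comp]
  by_cases hj : j = t
  · subst hj
    rw [flipIf_self, flipIf_self, flipIf_ne _ hdt.symm, flipIf_ne _ hdt.symm, flipIf_self]
    simp only [Finset.mem_insert, Finset.mem_singleton, forall_eq_or_imp, forall_eq,
      flipIf_ne _ hxd, flipIf_self, flipIf_ne _ hxt, flipIf_ne _ hdt, flipIf_cond ht,
      flipIf_cond hd]
    generalize y x = a
    generalize y d = b
    generalize y j = c
    rcases Classical.propComplete (∀ s ∈ S, y s = 1) with hp | hp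
    all_goals
      simp only [hp, and_true, and_false, if_true, if_false]
      revert a b c
      simp [Fin.forall_fin_two]
  · simp only [flipIf_ne _ hj]
    by_cases hj' : j = d
    · subst hj'
      rw [flipIf_self, flipIf_self]
      simp only [flipIf_ne _ hj, flipIf_cond ht]
    · simp only [flipIf_ne _ hj', flipIf_ne _ hj]

end Ctrl

/-! ### Circuits with gate counts, up to the Toffoli gate. -/

section Circuits
variable {κ : Type} [Fintype κ] [DecidableEq κ]

lemma circuitMatrix_append (C D : CliffordTCircuit κ) :
    circuitMatrix (C ++ D) = circuitMatrix D * circuitMatrix C := by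
  induction C with
  | nil => simp [circuitMatrix]
  | cons g C ih => simp [circuitMatrix, ih, Matrix.mul_assoc]

lemma circuitMatrix_replicate (g : CliffordTGate κ) (k : ℕ) :
    circuitMatrix (List.replicate k g) = g.toMatrix ^ k := by
  induction k with
  | zero => simp [circuitMatrix]
  | succ k ih => simp [List.replicate_succ, circuitMatrix, ih, pow_succ]

/-- The primitive eighth root of unity `e^{iπ/4}`. -/
noncomputable def omega8 : ℂ := Complex.exp (Complex.I * Real.pi / 4)

lemma omega8_eq : omega8 = ((1 / Real.sqrt 2 : ℝ) : ℂ) * (1 + Complex.I) := by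
  have h : Complex.I * Real.pi / 4 = ((Real.pi / 4 : ℝ) : ℂ) * Complex.I := by
    push_cast; ring
  rw [omega8, h, Complex.exp_mul_I, ← Complex.ofReal_cos, ← Complex.ofReal_sin,
    Real.cos_pi_div_four, Real.sin_pi_div_four, Real.sqrt_div_self', mul_add, mul_one]

lemma inv_sqrt_two_sq : ((1 / Real.sqrt 2 : ℝ) : ℂ) ^ 2 = 1 / 2 := by
  rw [← Complex.ofReal_pow, div_pow, Real.sq_sqrt (by norm_num)]
  norm_num

lemma omega8_sq : omega8 ^ 2 = Complex.I := by
  rw [omega8_eq, mul_pow, inv_sqrt_two_sq]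
  linear_combination (1 / 2 : ℂ) * Complex.I_sq

lemma omega8_pow_four : omega8 ^ 4 = -1 := by
  rw [show 4 = 2 * 2 from rfl, pow_mul, omega8_sq, Complex.I_sq]

lemma omega8_pow_eight : omega8 ^ 8 = 1 := by
  rw [show 8 = 4 * 2 from rfl, pow_mul, omega8_pow_four]; norm_num

lemma star_omega8 : star omega8 = omega8 ^ 7 := by
  have h : star omega8 * omega8 = 1 := by
    rw [omega8_eq]
    simp only [star_mul', Complex.star_def, map_add, map_one, Complex.conj_I, Complex.conj_ofReal]
    linear_combination 2 * inv_sqrt_two_sq -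
      ((1 / Real.sqrt 2 : ℝ) : ℂ) ^ 2 * Complex.I_sq
  calc star omega8 = star omega8 * omega8 ^ 8 := by rw [omega8_pow_eight, mul_one]
    _ = star omega8 * omega8 * omega8 ^ 7 := by ring
    _ = _ := by rw [h, one_mul]

lemma phaseMatrix_eq : phaseMatrix = Matrix.diagonal ![1, Complex.I] := by
  ext i j; fin_cases i <;> fin_cases j <;> simp [phaseMatrix]

lemma tMatrix_eq : tMatrix = Matrix.diagonal ![1, omega8] := by
  ext i j; fin_cases i <;> fin_cases j <;> simp [tMatrix, omega8]

lemma tMatrix_pow (k : ℕ) : tMatrix ^ k = Matrix.diagonal ![1, omega8 ^ k] := by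
  rw [tMatrix_eq, Matrix.diagonal_pow]
  congr 1; ext i; fin_cases i <;> simp

lemma tMatrix_sq : tMatrix ^ 2 = phaseMatrix := by
  rw [tMatrix_pow, omega8_sq, phaseMatrix_eq]

lemma tMatrix_pow_eight : tMatrix ^ 8 = 1 := by
  rw [tMatrix_pow, omega8_pow_eight, ← Matrix.diagonal_one]
  congr 1; ext i; fin_cases i <;> simp

lemma tMatrix_conjTranspose : tMatrixᴴ = tMatrix ^ 7 := by
  rw [tMatrix_pow, tMatrix_eq, Matrix.diagonal_conjTranspose, ← star_omega8]
  congr 1; ext i; fin_cases i <;> simp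

lemma hadamardMatrix_conjTranspose : hadamardMatrixᴴ = hadamardMatrix := by
  ext i j; fin_cases i <;> fin_cases j <;> simp [hadamardMatrix]

lemma hadamardMatrix_mul_self : hadamardMatrix * hadamardMatrix = 1 := by
  have h := inv_sqrt_two_sq
  rw [hadamardMatrix, Matrix.smul_mul, Matrix.mul_smul, smul_smul, ← pow_two, h]
  ext i j; fin_cases i <;> fin_cases j <;> simp <;> norm_num

/-- `V` is the operator of a circuit with at most `m` gates. -/
def Impl (m : ℕ) (V : Matrix (BasisState κ) (BasisState κ) ℂ) : Prop :=
  ∃ C : CliffordTCircuit κ, C.length ≤ m ∧ circuitMatrix C = V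

lemma Impl.mono {m k : ℕ} {V : Matrix (BasisState κ) (BasisState κ) ℂ} (h : Impl m V)
    (hmk : m ≤ k) : Impl k V := by
  obtain ⟨C, hC, rfl⟩ := h
  exact ⟨C, hC.trans hmk, rfl⟩

lemma Impl.congr {m k : ℕ} {V W : Matrix (BasisState κ) (BasisState κ) ℂ} (h : Impl m V)
    (hmk : m ≤ k) (hVW : V = W) : Impl k W := hVW ▸ h.mono hmk

lemma Impl.mul {m k : ℕ} {V W : Matrix (BasisState κ) (BasisState κ) ℂ} (hV : Impl m V)
    (hW : Impl k W) : Impl (m + k) (V * W) := by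
  obtain ⟨C, hC, rfl⟩ := hV
  obtain ⟨D, hD, rfl⟩ := hW
  exact ⟨D ++ C, by rw [List.length_append]; omega, circuitMatrix_append _ _⟩

lemma impl_one : Impl 0 (1 : Matrix (BasisState κ) (BasisState κ) ℂ) := ⟨[], by simp, rfl⟩

lemma CliffordTGate.impl_pow (g : CliffordTGate κ) (k : ℕ) : Impl k (g.toMatrix ^ k) :=
  ⟨List.replicate k g, by simp, circuitMatrix_replicate g k⟩

lemma CliffordTGate.impl (g : CliffordTGate κ) : Impl 1 g.toMatrix :=
  ⟨[g], by simp, by simp [circuitMatrix]⟩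

lemma impl_hadamard (q : κ) : Impl 1 (onQubit q hadamardMatrix) := by
  exact (CliffordTGate.hadamard q).impl

lemma impl_t_pow (q : κ) (k : ℕ) : Impl k (onQubit q (tMatrix ^ k)) := by
  rw [← onQubit_pow]
  exact (CliffordTGate.tGate q).impl_pow k

lemma impl_cnot {c t : κ} (h : c ≠ t) : Impl 1 (mcx {c} t) := by
  rw [← cnotMatrix_eq_mcx]
  exact (CliffordTGate.cnot c t h).impl

/-- Inverses are not in the gate set, but `T` has order 8: the inverse of `T` is `T ^ 7` and that of
the phase gate is `T ^ 6`. Hence the factor 7 for inverting any circuit. -/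
lemma CliffordTGate.conjTranspose_mul (g : CliffordTGate κ) : g.toMatrixᴴ * g.toMatrix = 1 ∧
    Impl 7 g.toMatrixᴴ := by
  cases g with
  | hadamard q =>
    simp only [toMatrix, onQubit_conjTranspose, hadamardMatrix_conjTranspose, onQubit_mul,
      hadamardMatrix_mul_self, onQubit_one, true_and]
    exact (impl_hadamard q).mono (by norm_num)
  | phase q =>
    simp only [toMatrix, onQubit_conjTranspose, ← tMatrix_sq, Matrix.conjTranspose_pow,
      onQubit_mul, tMatrix_conjTranspose]
    rw [← pow_mul, ← pow_add, show 7 * 2 + 2 = 8 * 2 from rfl, pow_mul, tMatrix_pow_eight,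
      one_pow, onQubit_one]
    refine ⟨rfl, ?_⟩
    rw [show 7 * 2 = 8 + 6 from rfl, pow_add, tMatrix_pow_eight, one_mul]
    exact (impl_t_pow q 6).mono (by norm_num)
  | tGate q =>
    simp only [toMatrix, onQubit_conjTranspose, onQubit_mul, tMatrix_conjTranspose]
    rw [← pow_succ, tMatrix_pow_eight, onQubit_one]
    exact ⟨rfl, impl_t_pow q 7⟩
  | cnot c t h =>
    have ht : t ∉ ({c} : Finset κ) := by simpa using h.symm
    simp only [toMatrix, cnotMatrix_eq_mcx]
    rw [mcx_conjTranspose ht, mcx_mul_self ht]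
    exact ⟨rfl, (impl_cnot h).mono (by norm_num)⟩

lemma circuitMatrix_conjTranspose_mul (C : CliffordTCircuit κ) :
    (circuitMatrix C)ᴴ * circuitMatrix C = 1 ∧ Impl (7 * C.length) (circuitMatrix C)ᴴ := by
  induction C with
  | nil => simpa [circuitMatrix] using impl_one
  | cons g C ih =>
    obtain ⟨hg, hg'⟩ := g.conjTranspose_mul
    rw [circuitMatrix, Matrix.conjTranspose_mul]
    constructor
    · rw [Matrix.mul_assoc, ← Matrix.mul_assoc _ (circuitMatrix C), ih.1, Matrix.one_mul, hg]
    · exact (hg'.mul ih.2).mono (by simp; omega)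

lemma Impl.conjTranspose_mul {m : ℕ} {V : Matrix (BasisState κ) (BasisState κ) ℂ}
    (h : Impl m V) : Vᴴ * V = 1 := by
  obtain ⟨C, hC, rfl⟩ := h
  exact (circuitMatrix_conjTranspose_mul C).1

lemma Impl.mul_conjTranspose {m : ℕ} {V : Matrix (BasisState κ) (BasisState κ) ℂ}
    (h : Impl m V) : V * Vᴴ = 1 := mul_eq_one_comm.1 h.conjTranspose_mul

lemma Impl.conjTranspose {m : ℕ} {V : Matrix (BasisState κ) (BasisState κ) ℂ}
    (h : Impl m V) : Impl (7 * m) Vᴴ := by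
  obtain ⟨C, hC, rfl⟩ := h
  exact (circuitMatrix_conjTranspose_mul C).2.mono (by omega)

lemma notMatrix_eq : notMatrix = hadamardMatrix * tMatrix ^ 4 * hadamardMatrix := by
  have h := inv_sqrt_two_sq
  rw [tMatrix_pow, omega8_pow_four, hadamardMatrix, Matrix.mul_smul, Matrix.smul_mul,
    Matrix.smul_mul, smul_smul, ← pow_two, h]
  ext i j; fin_cases i <;> fin_cases j <;>
    simp [Matrix.mul_apply, Fin.sum_univ_two, notMatrix, Matrix.vecMul, dotProduct,
      Matrix.diagonal_apply] <;> norm_num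

lemma impl_not (q : κ) : Impl 6 (onQubit q notMatrix) := by
  rw [notMatrix_eq, ← onQubit_mul, ← onQubit_mul]
  exact ((impl_hadamard q).mul (impl_t_pow q 4)).mul (impl_hadamard q)

lemma onQubit_t_pow (q : κ) (k : ℕ) :
    onQubit q (tMatrix ^ k) = Matrix.diagonal fun x => ![1, omega8 ^ k] (x q) := by
  rw [tMatrix_pow, onQubit_diagonal]

/-- A phase controlled by the parity of two wires. -/
lemma impl_parity_two {a b : κ} (hab : a ≠ b) (k : ℕ) :
    Impl (k + 2) (Matrix.diagonal fun x : BasisState κ => ![1, omega8 ^ k] (x b + x a)) := by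
  have h := ((impl_cnot hab).mul (impl_t_pow b k)).mul (impl_cnot hab)
  rw [onQubit_t_pow, mcx,
    funMatrix_conj_diagonal (flipIf_flipIf (by simpa using hab.symm))] at h
  refine h.congr (by omega) ?_
  congr 1
  ext x
  simp only [Function.comp, flipIf_self, Finset.mem_singleton, forall_eq]
  generalize x a = u
  revert u; simp [Fin.forall_fin_two]

/-- A phase controlled by the parity of three wires. -/
lemma impl_parity_three {a b c : κ} (hbc : b ≠ c) (hac : a ≠ c) (k : ℕ) :
    Impl (k + 4)
      (Matrix.diagonal fun x : BasisState κ => ![1, omega8 ^ k] (x c + x b + x a)) := by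
  have h := ((impl_cnot hac).mul (impl_parity_two hbc k)).mul (impl_cnot hac)
  rw [mcx, funMatrix_conj_diagonal (flipIf_flipIf (by simpa using hac.symm))] at h
  refine h.congr (by omega) ?_
  congr 1
  ext x
  simp only [Function.comp, flipIf_self, Finset.mem_singleton, forall_eq, flipIf_ne _ hbc]
  congr 1
  generalize x a = u
  generalize x b = v
  generalize x c = w
  revert u v w; decide

/-- For bits, `4abc = a + b + c - (a⊕b) - (b⊕c) - (a⊕c) + (a⊕b⊕c)`, and `omega8 ^ 4 = -1`. Each
parity on the right is one phase; exponent 7 stands for the coefficient -1. -/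
lemma impl_ccz {a b c : κ} (hab : a ≠ b) (hbc : b ≠ c) (hac : a ≠ c) :
    Impl 37 (Matrix.diagonal fun x : BasisState κ =>
      if x a = 1 ∧ x b = 1 ∧ x c = 1 then (-1 : ℂ) else 1) := by
  have h1 := impl_t_pow a 1
  have h2 := impl_t_pow b 1
  have h3 := impl_t_pow c 1
  rw [onQubit_t_pow] at h1 h2 h3
  have h := (((((h1.mul h2).mul h3).mul (impl_parity_two hab 7)).mul
    (impl_parity_two hbc 7)).mul (impl_parity_two hac 7)).mul (impl_parity_three hbc hac 1)
  simp only [Matrix.diagonal_mul_diagonal] at h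
  refine h.congr (by norm_num) ?_
  congr 1
  ext x
  have h4 := omega8_pow_four
  have h8 := omega8_pow_eight
  generalize x a = u
  generalize x b = v
  generalize x c = w
  revert u v w
  simp only [Fin.forall_fin_two]
  simp
  refine ⟨⟨?_, ?_⟩, ?_, ?_⟩ <;>
  first
    | linear_combination (omega8 ^ 8 + 1) * h8
    | linear_combination h4

lemma update_cond {S : Finset κ} {t : κ} (ht : t ∉ S) (x : BasisState κ) (b : Fin 2) :
    (∀ s ∈ S, Function.update x t b s = 1) ↔ ∀ s ∈ S, x s = 1 := by
  refine forall₂_congr fun s hs => ?_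
  rw [Function.update_of_ne]
  rintro rfl; exact ht hs

/-- An operator on the wire `t`, controlled by the wires in `S`, conjugated by one-qubit gates. -/
lemma onQubit_mul_ctrl_mul {S : Finset κ} {t : κ} (ht : t ∉ S)
    {A B : Matrix (Fin 2) (Fin 2) ℂ} (hAB : A * B = 1) (M : Matrix (Fin 2) (Fin 2) ℂ) :
    onQubit t A * ctrl t (fun x => if ∀ s ∈ S, x s = 1 then M else 1) * onQubit t B =
      ctrl t fun x => if ∀ s ∈ S, x s = 1 then A * M * B else 1 := by
  rw [onQubit_eq_ctrl, onQubit_eq_ctrl, ctrl_mul, ctrl_mul]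
  · congr 1
    ext1 x
    split_ifs <;> simp [hAB]
  · intro x b; rfl
  · intro x b; simp only [update_cond ht]

lemma impl_toffoli {a b t : κ} (hab : a ≠ b) (hbt : b ≠ t) (hat : a ≠ t) :
    Impl 39 (mcx {a, b} t) := by
  have h := ((impl_hadamard t).mul (impl_ccz hab hbt hat)).mul (impl_hadamard t)
  refine h.congr (by norm_num) ?_
  have ht : t ∉ ({a, b} : Finset κ) := by simp [hbt.symm, hat.symm]
  have hz : (Matrix.diagonal fun x : BasisState κ =>
      if x a = 1 ∧ x b = 1 ∧ x t = 1 then (-1 : ℂ) else 1) =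
      ctrl t fun x => if ∀ s ∈ ({a, b} : Finset κ), x s = 1 then tMatrix ^ 4 else 1 := by
    rw [diagonal_eq_ctrl t]
    congr 1
    ext1 x
    simp only [Finset.mem_insert, Finset.mem_singleton, forall_eq_or_imp, forall_eq,
      Function.update_of_ne hbt, Function.update_of_ne hat, Function.update_self, tMatrix_pow,
      omega8_pow_four]
    split_ifs with h1
    · congr 1; ext i; fin_cases i <;> simp [h1]
    · rw [← Matrix.diagonal_one]
      congr 1; ext i; fin_cases i <;> simp; tauto
  rw [hz, mcx_eq_ctrl ht, onQubit_mul_ctrl_mul ht hadamardMatrix_mul_self, notMatrix_eq]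

end Circuits

/-! ### Multiply controlled gates of linear size with borrowed wires. -/

section MultiControlled
variable {κ : Type} [Fintype κ] [DecidableEq κ]

/-- Restoring each borrowed wire at every level of the recursion would make the cost exponential.
Instead the disturbance `Q` of the wires in `D` is kept, and only two Toffolis (78 gates) are added
per control; both `Q` and `mcx S t * Q` stay linear, so `Q` is undone once at the end. The
commutation clause lets the outer Toffoli pass the inner `Q`. -/
lemma exists_dirty_ladder (S : Finset κ) : S.Nonempty → ∀ (t : κ) (D : Finset κ), t ∉ S →
    Disjoint S D → t ∉ D → S.card ≤ D.card + 1 →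
    ∃ Q : Matrix (BasisState κ) (BasisState κ) ℂ, Impl (78 * S.card) Q ∧
      Impl (78 * S.card) (mcx S t * Q) ∧
      ∀ (A : Finset κ) (u : κ), Disjoint A D → u ∉ S → mcx A u * Q = Q * mcx A u := by
  induction S using Finset.induction_on with
  | empty => simp
  | insert x S' hx ih =>
    intro _ t D ht hSD htD hcard
    rcases S'.eq_empty_or_nonempty with rfl | hne
    · refine ⟨1, impl_one.mono (by simp), ?_, by simp⟩
      have hxt : x ≠ t := by rintro rfl; simp at ht
      simpa using (impl_cnot hxt).mono (by norm_num)
    · rw [Finset.card_insert_of_notMem hx] at hcard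
      have hD : D.Nonempty := by
        rw [← Finset.card_pos]
        have := hne.card_pos
        omega
      obtain ⟨d, hd⟩ := hD
      have hdS : d ∉ insert x S' := fun h => Finset.disjoint_left.1 hSD h hd
      have hdS' : d ∉ S' := fun h => hdS (Finset.mem_insert_of_mem h)
      have htS' : t ∉ S' := fun h => ht (Finset.mem_insert_of_mem h)
      have hxt : x ≠ t := by rintro rfl; simp at ht
      have hxd : x ≠ d := by rintro rfl; simp at hdS
      have hdt : d ≠ t := by rintro rfl; exact htD hd
      have hxD : x ∉ D := fun h => Finset.disjoint_left.1 hSD (Finset.mem_insert_self x S') h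
      obtain ⟨Q, hQ, hQ', hcomm⟩ := ih hne d (D.erase d) hdS'
        ((Finset.disjoint_insert_left.1 hSD).2.mono_right (Finset.erase_subset d D))
        (Finset.notMem_erase d D) (by rw [Finset.card_erase_of_mem hd]; omega)
      refine ⟨mcx S' d * Q, hQ'.mono (by gcongr; exact Finset.subset_insert x S'), ?_, ?_⟩
      · have hT := impl_toffoli hxd hdt hxt
        refine ((hT.mul hQ').mul hT).congr ?_ ?_
        · rw [Finset.card_insert_of_notMem hx]; omega
        · have h1 := hcomm {x, d} t (by
            rw [Finset.disjoint_left]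
            intro a ha hae
            simp only [Finset.mem_insert, Finset.mem_singleton] at ha
            rcases ha with rfl | rfl
            · exact hxD (Finset.mem_of_mem_erase hae)
            · exact Finset.notMem_erase _ D hae) htS'
          rw [← Matrix.mul_assoc (mcx (insert x S') t),
            ← mcx_insert_dirty hxd hxt hdt hdS' htS', Matrix.mul_assoc _ _ Q, h1]
          simp only [Matrix.mul_assoc]
      · intro A u hA hu
        have hdA : d ∉ A := fun h => Finset.disjoint_left.1 hA h hd
        have huS' : u ∉ S' := fun h => hu (Finset.mem_insert_of_mem h)
        rw [← Matrix.mul_assoc, mcx_comm huS' hdA, Matrix.mul_assoc,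
          hcomm A u (hA.mono_right (Finset.erase_subset d D)) huS', Matrix.mul_assoc]

/-- A multiply controlled NOT of linear size that borrows the wires in `D`. -/
lemma impl_mcx {S D : Finset κ} {t : κ} (hS : S.Nonempty) (ht : t ∉ S) (hSD : Disjoint S D)
    (htD : t ∉ D) (hcard : S.card ≤ D.card + 1) : Impl (624 * S.card) (mcx S t) := by
  obtain ⟨Q, hQ, hQ', -⟩ := exists_dirty_ladder S hS t D ht hSD htD hcard
  -- The count is `78 + 7 * 78 = 624` per control.
  refine (hQ'.mul hQ.conjTranspose).congr (by omega) ?_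
  rw [Matrix.mul_assoc, hQ.mul_conjTranspose, Matrix.mul_one]

lemma ctrl_conjTranspose (q : κ) {f : BasisState κ → Matrix (Fin 2) (Fin 2) ℂ}
    (hf : ∀ x b, f (Function.update x q b) = f x) :
    (ctrl q f)ᴴ = ctrl q fun x => (f x)ᴴ := by
  ext x y
  have : (∀ j, j ≠ q → y j = x j) ↔ ∀ j, j ≠ q → x j = y j := by
    simp only [eq_comm]
  simp only [ctrl, Matrix.conjTranspose_apply, Matrix.of_apply, this]
  split_ifs with h
  · rw [(agree_off_iff q x y).1 h, hf]
  · simp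

/-- The matrix `-iX`. -/
noncomputable def negINotMatrix : Matrix (Fin 2) (Fin 2) ℂ := !![0, -Complex.I; -Complex.I, 0]

lemma diagonal_fin_two (a b : ℂ) : Matrix.diagonal ![a, b] = !![a, 0; 0, b] := by
  ext i j; fin_cases i <;> fin_cases j <;> simp

lemma not_mul_t_commutator : notMatrix * tMatrix ^ 7 * notMatrix * tMatrix =
    Matrix.diagonal ![omega8 ^ 7, omega8] := by
  rw [tMatrix_pow, tMatrix_eq, diagonal_fin_two, diagonal_fin_two, diagonal_fin_two, notMatrix]
  ext i j; fin_cases i <;> fin_cases j <;> simp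

/-- The commutator of `X` with the inverse of `T` is diagonal of determinant 1; its square is `-iZ`,
which the Hadamards turn into `-iX`. Dropping one or both of the `X` pairs yields 1, so controlling
the two pairs separately controls `-iX` by their conjunction. -/
lemma hadamard_conj_commutator : hadamardMatrix *
    (notMatrix * tMatrix ^ 7 * notMatrix * tMatrix *
      (notMatrix * tMatrix ^ 7 * notMatrix * tMatrix)) * hadamardMatrix = negINotMatrix := by
  have h := inv_sqrt_two_sq
  have h1 : omega8 ^ 7 * omega8 ^ 7 = -Complex.I := by
    linear_combination (omega8 ^ 6) * omega8_pow_eight + omega8 ^ 2 * omega8_pow_four - omega8_sq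
  have h2 : omega8 * omega8 = Complex.I := by rw [← omega8_sq, pow_two]
  rw [not_mul_t_commutator, Matrix.diagonal_mul_diagonal, hadamardMatrix, Matrix.smul_mul,
    Matrix.smul_mul, Matrix.mul_smul, smul_smul, ← pow_two, h]
  have h3 : (Matrix.diagonal fun i => ![omega8 ^ 7, omega8] i * ![omega8 ^ 7, omega8] i) =
      !![-Complex.I, 0; 0, Complex.I] := by
    ext i j; fin_cases i <;> fin_cases j <;> simp [h1, h2]
  rw [h3]
  ext i j; fin_cases i <;> fin_cases j <;>
    simp [negINotMatrix] <;> ring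

lemma negINotMatrix_conj : negINotMatrixᴴ * tMatrix * negINotMatrix =
    Matrix.diagonal ![omega8, 1] := by
  rw [tMatrix_eq, diagonal_fin_two, diagonal_fin_two, negINotMatrix]
  ext i j; fin_cases i <;> fin_cases j <;> simp [Matrix.mul_apply, Fin.sum_univ_two]
  linear_combination -omega8 * Complex.I_sq

/-- The multiply controlled `-iX`, with the controls split into two halves. -/
lemma impl_mc_negINot {S T : Finset κ} {c : κ} (hS : S.Nonempty) (hT : T.Nonempty)
    (hST : Disjoint S T) (hcS : c ∉ S) (hcT : c ∉ T) (h₁ : S.card ≤ T.card + 1)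
    (h₂ : T.card ≤ S.card + 1) : Impl (1248 * (S.card + T.card) + 18)
      (ctrl c fun x => if ∀ s ∈ S ∪ T, x s = 1 then negINotMatrix else 1) := by
  -- Each half of the controls serves as the borrowed wires of the other half, so no further wire is
  -- needed.
  have hX := impl_mcx hS hcS hST hcT h₁
  have hY := impl_mcx hT hcT hST.symm hcS h₂
  have hA := ((hX.mul (impl_t_pow c 7)).mul hY).mul (impl_t_pow c 1)
  have hH := impl_hadamard c
  refine ((hH.mul (hA.mul hA)).mul hH).congr (by omega) ?_
  have hiS : ∀ (x : BasisState κ) (b : Fin 2),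
      (if ∀ s ∈ S, Function.update x c b s = 1 then notMatrix else 1) =
        if ∀ s ∈ S, x s = 1 then notMatrix else 1 := fun x b => by simp only [update_cond hcS]
  have hiT : ∀ (x : BasisState κ) (b : Fin 2),
      (if ∀ s ∈ T, Function.update x c b s = 1 then notMatrix else 1) =
        if ∀ s ∈ T, x s = 1 then notMatrix else 1 := fun x b => by simp only [update_cond hcT]
  rw [mcx_eq_ctrl hcS, mcx_eq_ctrl hcT, pow_one]
  simp only [onQubit_eq_ctrl]
  rw [ctrl_mul c _ _ fun _ _ => rfl, ctrl_mul c _ _ hiT, ctrl_mul c _ _ fun _ _ => rfl,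
    ctrl_mul, ctrl_mul, ctrl_mul c _ _ fun _ _ => rfl]
  · congr 1
    ext1 x
    have hu : (∀ s ∈ S ∪ T, x s = 1) ↔ (∀ s ∈ S, x s = 1) ∧ ∀ s ∈ T, x s = 1 := by
      simp only [Finset.mem_union, or_imp, forall_and]
    have hXX : notMatrix * notMatrix = 1 := by
      ext i j; fin_cases i <;> fin_cases j <;> simp [notMatrix]
    have h7 : tMatrix ^ 7 * tMatrix = 1 := by rw [← pow_succ, tMatrix_pow_eight]
    have h3 : notMatrix * tMatrix ^ 7 * tMatrix * (notMatrix * tMatrix ^ 7 * tMatrix) = 1 := by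
      rw [Matrix.mul_assoc notMatrix, h7, Matrix.mul_one, hXX]
    have h4 : tMatrix ^ 7 * notMatrix * tMatrix * (tMatrix ^ 7 * notMatrix * tMatrix) = 1 := by
      have : tMatrix * tMatrix ^ 7 = 1 := by rw [← pow_succ', tMatrix_pow_eight]
      calc _ = tMatrix ^ 7 * (notMatrix * (tMatrix * tMatrix ^ 7) * notMatrix) * tMatrix := by
            simp only [Matrix.mul_assoc]
        _ = 1 := by rw [this, Matrix.mul_one, hXX, Matrix.mul_one, h7]
    rw [if_congr hu rfl rfl]
    by_cases hs : ∀ s ∈ S, x s = 1 <;> by_cases ht : ∀ s ∈ T, x s = 1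
    · rw [if_pos hs, if_pos ht, if_pos ⟨hs, ht⟩, hadamard_conj_commutator]
    · rw [if_pos hs, if_neg ht, if_neg fun h => ht h.2, Matrix.mul_one, h3, Matrix.mul_one,
        hadamardMatrix_mul_self]
    · rw [if_neg hs, if_pos ht, if_neg fun h => hs h.1, Matrix.one_mul, h4, Matrix.mul_one,
        hadamardMatrix_mul_self]
    · rw [if_neg hs, if_neg ht, if_neg fun h => hs h.1, Matrix.one_mul, Matrix.mul_one, h7,
        Matrix.mul_one, Matrix.mul_one, hadamardMatrix_mul_self]
  · intro x b; simp only [update_cond hcS, update_cond hcT]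
  · intro x b; simp only [update_cond hcS, update_cond hcT]

/-- Conjugating `T` on `c` by the controlled `-iX` swaps the two diagonal entries of `T` when the
controls are on, and the factor `-i` cancels. With `c` in state 0 the net effect is a phase `omega8`
on the all-ones state of `S`. Two controls at least are needed for both halves to be nonempty. -/
lemma impl_phase_gadget {S : Finset κ} {c : κ} (hS : 2 ≤ S.card) (hc : c ∉ S) :
    Impl (9984 * S.card + 145) (ctrl c fun x => if ∀ s ∈ S, x s = 1 then
      Matrix.diagonal ![omega8, 1] else Matrix.diagonal ![1, omega8]) := by
  obtain ⟨A, hA, hAc⟩ := Finset.exists_subset_card_eq (show S.card / 2 ≤ S.card by omega)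
  have hB : (S \ A).card = S.card - S.card / 2 := by rw [Finset.card_sdiff_of_subset hA, hAc]
  have hD := impl_mc_negINot (S := A) (T := S \ A) (c := c)
    (Finset.card_pos.1 (by omega)) (Finset.card_pos.1 (by omega)) Finset.disjoint_sdiff
    (fun h => hc (hA h)) (fun h => hc (Finset.sdiff_subset h)) (by omega) (by omega)
  rw [Finset.union_sdiff_of_subset hA] at hD
  have hi : ∀ (x : BasisState κ) (b : Fin 2),
      (if ∀ s ∈ S, Function.update x c b s = 1 then negINotMatrix else 1) =
        if ∀ s ∈ S, x s = 1 then negINotMatrix else 1 := fun x b => by simp only [update_cond hc]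
  refine ((hD.conjTranspose.mul (impl_t_pow c 1)).mul hD).congr (by omega) ?_
  rw [ctrl_conjTranspose c hi, onQubit_eq_ctrl, ctrl_mul c _ _ fun _ _ => rfl, ctrl_mul c _ _ hi]
  congr 1
  ext1 x
  split_ifs
  · rw [pow_one, negINotMatrix_conj]
  · simp [tMatrix_eq]

end MultiControlled

/-! ### Circuits that use one wire as a clean ancilla. -/

section CleanWire
variable {κ : Type} [Fintype κ] [DecidableEq κ]

/-- Adjoin the wire `c` in the state `0`. -/
def extendZero (c : κ) (y : BasisState {w // w ≠ c}) : BasisState κ :=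
  fun w => if h : w = c then 0 else y ⟨w, h⟩

/-- Forget the wire `c`. -/
def dropWire (c : κ) (x : BasisState κ) : BasisState {w // w ≠ c} := fun w => x w

/-- The isometry that adjoins the wire `c` in the state `|0⟩`. -/
def cleanWire (c : κ) : Matrix (BasisState κ) (BasisState {w // w ≠ c}) ℂ :=
  Matrix.of fun x y => if x = extendZero c y then 1 else 0

variable {c : κ}

lemma extendZero_self (y : BasisState {w // w ≠ c}) : extendZero c y c = 0 := by
  simp [extendZero]

lemma extendZero_coe (y : BasisState {w // w ≠ c}) (w : {w // w ≠ c}) :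
    extendZero c y w = y w := by
  simp [extendZero, w.2]

lemma eq_extendZero_iff (x : BasisState κ) (y : BasisState {w // w ≠ c}) :
    x = extendZero c y ↔ x c = 0 ∧ dropWire c x = y := by
  constructor
  · rintro rfl
    exact ⟨extendZero_self y, funext fun w => extendZero_coe y w⟩
  · rintro ⟨h0, rfl⟩
    ext w : 1
    by_cases h : w = c
    · subst h; rw [h0, extendZero_self]
    · exact (extendZero_coe (dropWire c x) ⟨w, h⟩).symm

lemma mul_cleanWire (A : Matrix (BasisState κ) (BasisState κ) ℂ) (x : BasisState κ)
    (y : BasisState {w // w ≠ c}) : (A * cleanWire c) x y = A x (extendZero c y) := by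
  simp [cleanWire, Matrix.mul_apply]

lemma cleanWire_mul {α : Type} (V : Matrix (BasisState {w // w ≠ c}) α ℂ)
    (x : BasisState κ) (y : α) :
    (cleanWire c * V) x y = if x c = 0 then V (dropWire c x) y else 0 := by
  simp only [cleanWire, Matrix.mul_apply, Matrix.of_apply, eq_extendZero_iff, ite_mul, one_mul,
    zero_mul]
  split_ifs with h <;> simp [h]

lemma extendZero_injective : Function.Injective (extendZero c) := fun x y h => by
  have := (eq_extendZero_iff (extendZero c x) y).1 h
  rw [← this.2]
  exact ((eq_extendZero_iff (extendZero c x) x).1 rfl).2.symm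

lemma cleanWire_conjTranspose_mul : (cleanWire c)ᴴ * cleanWire c = 1 := by
  ext x y
  simp only [cleanWire, Matrix.mul_apply, Matrix.conjTranspose_apply, Matrix.of_apply,
    mul_ite, mul_one, mul_zero, Finset.sum_ite_eq', Finset.mem_univ, if_true,
    extendZero_injective.eq_iff, Matrix.one_apply, @eq_comm _ y x]
  split_ifs <;> simp

/-- `V` is realized by a circuit with at most `m` gates that uses the wire `c` as a clean
ancilla. -/
def ImplClean (c : κ) (m : ℕ)
    (V : Matrix (BasisState {w // w ≠ c}) (BasisState {w // w ≠ c}) ℂ) : Prop :=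
  ∃ A : Matrix (BasisState κ) (BasisState κ) ℂ, Impl m A ∧ A * cleanWire c = cleanWire c * V

variable {m k : ℕ} {V W : Matrix (BasisState {w // w ≠ c}) (BasisState {w // w ≠ c}) ℂ}

lemma ImplClean.mono (h : ImplClean c m V) (hmk : m ≤ k) : ImplClean c k V := by
  obtain ⟨A, hA, h⟩ := h
  exact ⟨A, hA.mono hmk, h⟩

lemma ImplClean.congr (h : ImplClean c m V) (hmk : m ≤ k) (hVW : V = W) : ImplClean c k W :=
  hVW ▸ h.mono hmk

lemma ImplClean.mul (hV : ImplClean c m V) (hW : ImplClean c k W) :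
    ImplClean c (m + k) (V * W) := by
  obtain ⟨A, hA, hA'⟩ := hV
  obtain ⟨B, hB, hB'⟩ := hW
  refine ⟨A * B, hA.mul hB, ?_⟩
  rw [Matrix.mul_assoc, hB', ← Matrix.mul_assoc, hA', Matrix.mul_assoc]

lemma implClean_one : ImplClean c 0 1 := ⟨1, impl_one, by simp⟩

lemma ImplClean.conjTranspose_mul (h : ImplClean c m V) : Vᴴ * V = 1 := by
  obtain ⟨A, hA, h⟩ := h
  have h1 : (cleanWire c * V)ᴴ * (cleanWire c * V) = 1 := by
    rw [← h, Matrix.conjTranspose_mul, Matrix.mul_assoc, ← Matrix.mul_assoc _ A,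
      hA.conjTranspose_mul, Matrix.one_mul, cleanWire_conjTranspose_mul]
  rwa [Matrix.conjTranspose_mul, Matrix.mul_assoc, ← Matrix.mul_assoc _ (cleanWire c),
    cleanWire_conjTranspose_mul, Matrix.one_mul] at h1

lemma ImplClean.mul_conjTranspose (h : ImplClean c m V) : V * Vᴴ = 1 :=
  mul_eq_one_comm.1 h.conjTranspose_mul

/-- Since `V` is unitary, `A` maps the subspace where `c` is 0 onto itself, so the inverse of `A`
preserves it too. -/
lemma ImplClean.conjTranspose (h : ImplClean c m V) : ImplClean c (7 * m) Vᴴ := by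
  have hV := h.mul_conjTranspose
  obtain ⟨A, hA, h⟩ := h
  refine ⟨Aᴴ, hA.conjTranspose, ?_⟩
  calc Aᴴ * cleanWire c = Aᴴ * (cleanWire c * V) * Vᴴ := by
        rw [Matrix.mul_assoc, Matrix.mul_assoc, hV, Matrix.mul_one]
    _ = cleanWire c * Vᴴ := by
        rw [← h, ← Matrix.mul_assoc, hA.conjTranspose_mul, Matrix.one_mul]

lemma onQubit_mul_cleanWire (w : {w // w ≠ c}) (M : Matrix (Fin 2) (Fin 2) ℂ) :
    onQubit (w : κ) M * cleanWire c = cleanWire c * onQubit w M := by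
  ext x y
  rw [mul_cleanWire, cleanWire_mul]
  have h : (∀ j, j ≠ (w : κ) → x j = extendZero c y j) ↔
      x c = 0 ∧ ∀ j, j ≠ w → dropWire c x j = y j := by
    constructor
    · intro h
      refine ⟨by rw [h c (Ne.symm w.2), extendZero_self], fun j hj => ?_⟩
      rw [← extendZero_coe y j, ← h j (fun h => hj (Subtype.ext h))]
      rfl
    · rintro ⟨h0, h⟩ j hj
      by_cases hjc : j = c
      · rw [hjc, h0, extendZero_self]
      · have := h ⟨j, hjc⟩ (fun h => hj (congrArg Subtype.val h))
        rw [← extendZero_coe y ⟨j, hjc⟩] at this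
        exact this
  simp only [onQubit, Matrix.of_apply, h, extendZero_coe]
  by_cases h0 : x c = 0
  · simp [h0]; rfl
  · simp [h0]

lemma ImplClean.onQubit {w : {w // w ≠ c}} {M : Matrix (Fin 2) (Fin 2) ℂ}
    (h : Impl m (onQubit (w : κ) M)) : ImplClean c m (onQubit w M) :=
  ⟨_, h, onQubit_mul_cleanWire w M⟩

lemma funMatrix_mul_cleanWire {φ : BasisState κ → BasisState κ}
    {ψ : BasisState {w // w ≠ c} → BasisState {w // w ≠ c}}
    (h : ∀ y, φ (extendZero c y) = extendZero c (ψ y)) :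
    funMatrix φ * cleanWire c = cleanWire c * funMatrix ψ := by
  ext x y
  rw [mul_cleanWire, cleanWire_mul]
  simp only [funMatrix, Matrix.of_apply, h, eq_extendZero_iff]
  by_cases h0 : x c = 0
  · simp [h0]
  · simp [h0]

lemma implClean_cnot {a b : {w // w ≠ c}} (hab : a ≠ b) :
    ImplClean c 1 (funMatrix (flipIf {a} b)) := by
  refine ⟨_, impl_cnot (fun h => hab (Subtype.ext h)), funMatrix_mul_cleanWire fun y => ?_⟩
  rw [eq_extendZero_iff]
  refine ⟨by rw [flipIf_ne _ (Ne.symm b.2), extendZero_self], ?_⟩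
  ext w : 1
  by_cases hw : w = b
  · subst hw
    simp [dropWire, flipIf_self, extendZero_coe]
  · have hw' : (w : κ) ≠ b := fun h => hw (Subtype.ext h)
    simp [dropWire, flipIf_ne _ hw, flipIf_ne _ hw', extendZero_coe]

lemma implClean_not (w : {w // w ≠ c}) : ImplClean c 6 (funMatrix (flipIf ∅ w)) := by
  have h : onQubit w notMatrix = funMatrix (flipIf ∅ w) := by
    have := mcx_eq_ctrl (Finset.notMem_empty w)
    simp only [Finset.notMem_empty, IsEmpty.forall_iff, implies_true, if_true] at this
    exact this.symm
  rw [← h]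
  exact ImplClean.onQubit (impl_not _)

/-- The phase `e^{iπ/4}` on the all-ones state. -/
lemma implClean_phase_ones (hκ : 3 ≤ Fintype.card κ) :
    ImplClean c (10200 * Fintype.card κ) (Matrix.diagonal fun y : BasisState {w // w ≠ c} =>
      if ∀ w, y w = 1 then omega8 else 1) := by
  have hcard : (Finset.univ.erase c).card + 1 = Fintype.card κ := by
    rw [Finset.card_erase_add_one (Finset.mem_univ c), Finset.card_univ]
  -- All wires but `c` are controls; the bit 0 of `c` selects the first diagonal entry, `omega8` or
  -- 1.
  refine ⟨_, (impl_phase_gadget (S := Finset.univ.erase c) (by omega)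
    (Finset.notMem_erase _ _)).mono (by omega), ?_⟩
  ext x y
  rw [mul_cleanWire, cleanWire_mul, Matrix.diagonal_apply]
  have h1 : (∀ j, j ≠ c → x j = extendZero c y j) ↔ dropWire c x = y := by
    rw [funext_iff, Subtype.forall]
    exact forall₂_congr fun j hj => by rw [← extendZero_coe y ⟨j, hj⟩]; rfl
  simp only [ctrl, Matrix.of_apply, h1, extendZero_self]
  by_cases hxy : dropWire c x = y
  · have h2 : (∀ s ∈ Finset.univ.erase c, x s = 1) ↔ ∀ w, dropWire c x w = 1 := by
      simp [dropWire]
    rw [if_pos hxy, if_pos hxy, if_congr h2 rfl rfl]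
    generalize x c = a
    split_ifs with h3 h4 h4 <;> revert h4 <;> revert a <;> simp [Fin.forall_fin_two]
  · simp [hxy]

lemma implClean_translate (m : BasisState {w // w ≠ c}) (A : Finset {w // w ≠ c}) :
    ImplClean c (6 * A.card) (funMatrix fun y w => if w ∈ A then y w + m w else y w) := by
  induction A using Finset.induction_on with
  | empty => exact implClean_one.congr le_rfl (by rw [← funMatrix_id]; simp [Function.id_def])
  | insert a A ha ih =>
    rw [Finset.card_insert_of_notMem ha]
    by_cases hm : m a = 0
    · refine ih.congr (by omega) ?_
      congr 1
      ext1 y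
      ext w : 1
      by_cases hw : w = a
      · subst hw; simp [ha, hm]
      · simp [hw]
    · have hm' : m a = 1 := by revert hm; generalize m a = b; revert b; decide
      refine ((implClean_not a).mul ih).congr (by omega) ?_
      rw [funMatrix_mul]
      congr 1
      ext1 y
      ext w : 1
      by_cases hw : w = a
      · subst hw; simp [flipIf_self, ha, hm']
      · simp [flipIf_ne _ hw, hw]

lemma implClean_fanOut {t : {w // w ≠ c}} (A : Finset {w // w ≠ c}) (ht : t ∉ A) :
    ImplClean c A.card (funMatrix fun y w => if w ∈ A then y w + y t else y w) := by
  induction A using Finset.induction_on with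
  | empty => exact implClean_one.congr le_rfl (by rw [← funMatrix_id]; simp [Function.id_def])
  | insert a A ha ih =>
    rw [Finset.card_insert_of_notMem ha]
    have hta : t ≠ a := by rintro rfl; simp at ht
    have htA : t ∉ A := fun h => ht (Finset.mem_insert_of_mem h)
    refine ((implClean_cnot hta).mul (ih htA)).congr (by omega) ?_
    rw [funMatrix_mul]
    congr 1
    ext1 y
    ext w : 1
    by_cases hw : w = a
    · subst hw
      simp only [Function.comp, flipIf_self, Finset.mem_singleton, forall_eq, ha, htA, if_false,
        Finset.mem_insert, true_or, if_true]
      congr 1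
      generalize y t = b
      revert b; decide
    · simp [flipIf_ne _ hw, hw]

end CleanWire

/-! ### Operations on one or two basis states. -/

section TwoLevel
variable {κ : Type} [Fintype κ] [DecidableEq κ] {c : κ}

lemma implClean_phase_ones_pow (hκ : 3 ≤ Fintype.card κ) (k : ℕ) :
    ImplClean c (k * (10200 * Fintype.card κ))
      (Matrix.diagonal fun y : BasisState {w // w ≠ c} =>
        if ∀ w, y w = 1 then omega8 ^ k else 1) := by
  induction k with
  | zero =>
    refine (implClean_one (c := c)).congr (Nat.zero_le _) ?_
    rw [← Matrix.diagonal_one]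
    simp
  | succ k ih =>
    refine (ih.mul (implClean_phase_ones hκ)).congr (by rw [add_mul]; omega) ?_
    rw [Matrix.diagonal_mul_diagonal]
    congr 1
    ext1 y
    split_ifs <;> simp [pow_succ]

lemma card_ne_lt : Fintype.card {w // w ≠ c} + 1 = Fintype.card κ := by
  rw [Fintype.card_subtype_compl, Fintype.card_subtype_eq]
  have := Fintype.card_pos_iff.2 ⟨c⟩
  omega

lemma implClean_add (m : BasisState {w // w ≠ c}) :
    ImplClean c (6 * Fintype.card κ) (funMatrix fun y : BasisState {w // w ≠ c} => y + m) := by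
  refine (implClean_translate m Finset.univ).congr ?_ ?_
  · rw [Finset.card_univ]; have := card_ne_lt (c := c); omega
  · congr 1; ext1 y; ext w : 1; simp

lemma basisState_add_self {ι : Type} (x y : BasisState ι) : x + y + y = x := by
  ext w : 1
  exact fin_two_add_self _ _

/-- The phase `e^{iπk/4}` on a single basis state. -/
lemma implClean_phase (hκ : 3 ≤ Fintype.card κ) (b : BasisState {w // w ≠ c}) (k : ℕ) :
    ImplClean c ((k + 1) * (10200 * Fintype.card κ))
      (Matrix.diagonal fun y => if y = b then omega8 ^ k else 1) := by
  -- Adding the complement of `b` carries `b` to the all-ones state.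
  have hm := implClean_add (c := c) (b + fun _ => 1)
  refine ((hm.mul (implClean_phase_ones_pow hκ k)).mul hm).congr
    (by rw [add_mul k]; omega) ?_
  rw [funMatrix_conj_diagonal fun x => basisState_add_self _ _]
  congr 1
  ext1 y
  have : (∀ w, (y + (b + fun _ => 1) : BasisState {w // w ≠ c}) w = 1) ↔ y = b := by
    rw [funext_iff]
    refine forall_congr' fun w => ?_
    simp only [Pi.add_apply]
    generalize y w = u
    generalize b w = v
    revert u v; decide
  simp only [Function.comp, this]

lemma ctrl_mulVec {ι : Type} [Fintype ι] [DecidableEq ι] (q : ι)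
    (f : BasisState ι → Matrix (Fin 2) (Fin 2) ℂ) (ψ : BasisState ι → ℂ) (x : BasisState ι) :
    (ctrl q f *ᵥ ψ) x = ∑ b, f x (x q) b * ψ (Function.update x q b) := by
  rw [Matrix.mulVec, dotProduct]
  symm
  refine Fintype.sum_of_injective (fun b : Fin 2 => Function.update x q b)
    (Function.update_injective x q) _ _ ?_ ?_
  · intro z hz
    have : ¬ ∀ j, j ≠ q → x j = z j := by
      intro h
      refine hz ⟨z q, ?_⟩
      exact ((agree_off_iff q z x).1 fun j hj => (h j hj).symm).symm
    simp only [ctrl, Matrix.of_apply, if_neg this, zero_mul]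
  · intro b
    have h1 : ∀ j, j ≠ q → x j = Function.update x q b j := by
      intro j hj; simp [hj]
    simp only [ctrl, Matrix.of_apply, if_pos h1, Function.update_self]

/-- The Hadamard matrix is `A Z Aᴴ` with `A = S H T H` and `Z = T ^ 4`. Controlling only `Z` then
controls the Hadamard gate, and a controlled `Z` is a phase on the all-ones state. -/
lemma hadamardMatrix_eq_conj : tMatrix ^ 2 * hadamardMatrix * tMatrix * hadamardMatrix *
    tMatrix ^ 4 * (hadamardMatrix * tMatrix ^ 7 * hadamardMatrix * tMatrix ^ 6) =
      hadamardMatrix := by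
  have h := inv_sqrt_two_sq
  have h8 := omega8_pow_eight
  have h2 := omega8_sq
  have e : tMatrix * notMatrix * tMatrix ^ 7 = !![0, omega8 ^ 7; omega8, 0] := by
    rw [tMatrix_pow, tMatrix_eq, diagonal_fin_two, diagonal_fin_two, notMatrix]
    ext i j; fin_cases i <;> fin_cases j <;> simp
  have e1 : omega8 + omega8 ^ 7 = 2 * ((1 / Real.sqrt 2 : ℝ) : ℂ) := by
    rw [← star_omega8, omega8_eq]
    simp only [star_mul', Complex.star_def, map_add, map_one, Complex.conj_I, Complex.conj_ofReal]
    ring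
  have e2 : omega8 - omega8 ^ 7 = 2 * Complex.I * ((1 / Real.sqrt 2 : ℝ) : ℂ) := by
    rw [← star_omega8, omega8_eq]
    simp only [star_mul', Complex.star_def, map_add, map_one, Complex.conj_I, Complex.conj_ofReal]
    ring
  have h6 : omega8 ^ 6 = -Complex.I := by
    linear_combination omega8 ^ 2 * omega8_pow_four - omega8_sq
  calc _ = tMatrix ^ 2 * (hadamardMatrix * (tMatrix *
        (hadamardMatrix * tMatrix ^ 4 * hadamardMatrix) * tMatrix ^ 7) * hadamardMatrix) *
        tMatrix ^ 6 := by simp only [Matrix.mul_assoc]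
    _ = _ := by
      rw [← notMatrix_eq, e, tMatrix_pow, tMatrix_pow, h2, h6, diagonal_fin_two, diagonal_fin_two]
      simp only [hadamardMatrix, Matrix.smul_mul, Matrix.mul_smul, smul_smul, ← pow_two, h]
      generalize ((1 / Real.sqrt 2 : ℝ) : ℂ) = r at *
      ext i j; fin_cases i <;> fin_cases j <;> simp
      · linear_combination (1 / 2 : ℂ) * e1
      · linear_combination (1 / 2 : ℂ) * (-Complex.I) * e2 - r * Complex.I_sq
      · linear_combination (1 / 2 : ℂ) * (-Complex.I) * e2 - r * Complex.I_sq
      · linear_combination (1 / 2 : ℂ) * e1 - (1 / 2 : ℂ) * (omega8 + omega8 ^ 7) * Complex.I_sq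

/-- The Hadamard gate on a pair of basis states that differ in the wire `t` only. -/
lemma implClean_ctrl_hadamard (hκ : 3 ≤ Fintype.card κ) (t : {w // w ≠ c}) :
    ImplClean c (40820 * Fintype.card κ)
      (ctrl t fun x => if ∀ s ∈ Finset.univ.erase t, x s = 1 then hadamardMatrix else 1) := by
  have hT : ∀ k, ImplClean c k (onQubit t (tMatrix ^ k)) := fun k =>
    ImplClean.onQubit (impl_t_pow _ k)
  have hH : ImplClean c 1 (onQubit t hadamardMatrix) := ImplClean.onQubit (impl_hadamard _)
  have hA := (((hT 2).mul hH).mul (hT 1)).mul hH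
  have hB := ((hH.mul (hT 7)).mul hH).mul (hT 6)
  have h := (hA.mul (implClean_phase_ones_pow hκ 4)).mul hB
  simp only [onQubit_mul, pow_one] at h
  refine h.congr (by omega) ?_
  have ht := Finset.notMem_erase t Finset.univ
  have hz : (Matrix.diagonal fun x : BasisState {w // w ≠ c} =>
      if ∀ w, x w = 1 then omega8 ^ 4 else 1) =
      ctrl t fun x => if ∀ s ∈ Finset.univ.erase t, x s = 1 then tMatrix ^ 4 else 1 := by
    rw [diagonal_eq_ctrl t]
    congr 1
    ext1 x
    have h1 : ∀ b, (∀ w, Function.update x t b w = 1) ↔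
        b = 1 ∧ ∀ s ∈ Finset.univ.erase t, x s = 1 := by
      intro b
      constructor
      · intro h
        refine ⟨by simpa using h t, fun s hs => ?_⟩
        have := h s
        rwa [Function.update_of_ne (Finset.ne_of_mem_erase hs)] at this
      · rintro ⟨rfl, h⟩ w
        by_cases hw : w = t
        · subst hw; simp
        · rw [Function.update_of_ne hw]
          exact h w (by simp [hw])
    simp only [h1, tMatrix_pow]
    rcases Classical.propComplete (∀ s ∈ Finset.univ.erase t, x s = 1) with h2 | h2
    all_goals simp only [h2, and_true, and_false, if_true, if_false]
    · congr 1; ext i; fin_cases i <;> simp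
    · exact Matrix.diagonal_one
  rw [hz, onQubit_mul_ctrl_mul ht, hadamardMatrix_eq_conj]
  calc _ = tMatrix ^ 2 * (hadamardMatrix * (tMatrix *
        (hadamardMatrix * hadamardMatrix) * tMatrix ^ 7) * hadamardMatrix) *
        tMatrix ^ 6 := by simp only [Matrix.mul_assoc]
    _ = 1 := by
      rw [hadamardMatrix_mul_self, Matrix.mul_one, ← pow_succ', tMatrix_pow_eight, Matrix.mul_one,
        hadamardMatrix_mul_self, Matrix.mul_one, ← pow_add, tMatrix_pow_eight]

/-- The Hadamard gate on an arbitrary pair of basis states. -/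
lemma exists_implClean_hadamard_pair (hκ : 3 ≤ Fintype.card κ) {b b' : BasisState {w // w ≠ c}}
    (hb : b ≠ b') :
    ∃ V, ImplClean c (40840 * Fintype.card κ) V ∧ ∀ ψ, V *ᵥ ψ = fun y =>
      if y = b then ((1 / Real.sqrt 2 : ℝ) : ℂ) * (ψ b + ψ b') else
      if y = b' then ((1 / Real.sqrt 2 : ℝ) : ℂ) * (ψ b - ψ b') else ψ y := by
  obtain ⟨t, ht⟩ := Function.ne_iff.1 hb
  -- Fan-out from a wire `t` where `b` and `b'` differ makes them agree off `t`; the translation `m`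
  -- then sets those common bits to 1 and the bit at `t` to 0 for `b`, 1 for `b'`. The fully
  -- controlled Hadamard on `t` acts on exactly this pair.
  set A : Finset {w // w ≠ c} := Finset.univ.filter fun w => w ≠ t ∧ b w ≠ b' w with hA
  have htA : t ∉ A := by simp [hA]
  set σ : BasisState {w // w ≠ c} → BasisState {w // w ≠ c} :=
    fun y w => if w ∈ A then y w + y t else y w with hσ
  have hσt : ∀ y, σ y t = y t := fun y => by simp [hσ, htA]
  have hσσ : ∀ y, σ (σ y) = y := by
    intro y
    ext w : 1
    by_cases hw : w ∈ A
    · have : ∀ y, σ y w = y w + y t := fun y => by simp [hσ, hw]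
      rw [this, this, hσt, fin_two_add_self]
    · have : ∀ y, σ y w = y w := fun y => by simp [hσ, hw]
      rw [this, this]
  have hσ_eq : ∀ w, w ≠ t → σ b w = σ b' w := by
    intro w hw
    by_cases h : b w = b' w
    · simp [hσ, hA, h]
    · have : w ∈ A := by simp [hA, h, hw]
      simp only [hσ, this, if_true]
      revert h ht
      generalize b w = u1
      generalize b' w = u2
      generalize b t = u3
      generalize b' t = u4
      revert u1 u2 u3 u4; decide
  set m : BasisState {w // w ≠ c} := Function.update (fun w => σ b w + 1) t (b t) with hm
  have hmw : ∀ w, w ≠ t → m w = σ b w + 1 := fun w hw => by simp [hm, hw]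
  have hmt : m t = b t := by simp [hm]
  have hF : ImplClean c (Fintype.card κ) (funMatrix σ) :=
    (implClean_fanOut A htA).mono (by
      have h1 := Finset.card_le_univ A
      have h2 := card_ne_lt (c := c)
      omega)
  have hτ := implClean_add m
  refine ⟨funMatrix σ * funMatrix (fun y => y + m) *
    (ctrl t fun x => if ∀ s ∈ Finset.univ.erase t, x s = 1 then hadamardMatrix else 1) *
    funMatrix (fun y => y + m) * funMatrix σ, ?_, ?_⟩
  · exact ((((hF.mul hτ).mul (implClean_ctrl_hadamard hκ t)).mul hτ).mul hF).mono (by omega)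
  intro ψ
  ext y
  have hττ : ∀ y, y + m + m = y := fun y => basisState_add_self y m
  have hτv := funMatrix_mulVec (φ := fun y => y + m) (ψ := fun y => y + m) hττ hττ
  simp only [← Matrix.mulVec_mulVec]
  rw [funMatrix_mulVec hσσ hσσ, hτv, ctrl_mulVec]
  simp only [hτv, funMatrix_mulVec hσσ hσσ]
  have hinv : ∀ x y, σ x + m = y ↔ σ (y + m) = x := by
    intro x y
    constructor
    · rintro rfl; rw [hττ, hσσ]
    · rintro rfl; rw [hσσ, hττ]
  have hb0 : ∀ x, (∀ s ∈ Finset.univ.erase t, x s = 1) → σ (Function.update x t 0 + m) = b := by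
    intro x hx
    rw [← hinv]
    ext w : 1
    by_cases hw : w = t
    · rw [hw]
      simp only [Pi.add_apply, hσt, hmt, Function.update_self]
      generalize b t = u
      revert u; decide
    · simp only [Pi.add_apply, hmw w hw, Function.update_of_ne hw]
      rw [hx w (by simp [hw])]
      generalize σ b w = u
      revert u; decide
  have hb1 : ∀ x, (∀ s ∈ Finset.univ.erase t, x s = 1) → σ (Function.update x t 1 + m) = b' := by
    intro x hx
    rw [← hinv]
    ext w : 1
    by_cases hw : w = t
    · rw [hw]
      simp only [Pi.add_apply, hσt, hmt, Function.update_self]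
      revert ht
      generalize b t = u
      generalize b' t = v
      revert u v; decide
    · simp only [Pi.add_apply, hmw w hw, Function.update_of_ne hw, hσ_eq w hw]
      rw [hx w (by simp [hw])]
      generalize σ b' w = u
      revert u; decide
  have hy : σ (σ y + m + m) = y := by rw [hττ, hσσ]
  by_cases hs : ∀ s ∈ Finset.univ.erase t, (σ y + m) s = 1
  · rw [if_pos hs, Fin.sum_univ_two, hb0 _ hs, hb1 _ hs]
    rcases (show ∀ a : Fin 2, a = 0 ∨ a = 1 by decide) ((σ y + m) t) with h | h
    · have : y = b := by
        rw [← hb0 _ hs, ← h, Function.update_eq_self, hy]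
      rw [if_pos this, h]
      simp [hadamardMatrix]
      ring
    · have : y = b' := by
        rw [← hb1 _ hs, ← h, Function.update_eq_self, hy]
      rw [if_neg (fun h => hb (h.symm.trans this)), if_pos this, h]
      simp [hadamardMatrix]
      ring
  · have h1 : y ≠ b := by
      rintro rfl
      apply hs
      intro s hs
      rw [Pi.add_apply, hmw s (Finset.ne_of_mem_erase hs)]
      generalize σ y s = u
      revert u; decide
    have h2 : y ≠ b' := by
      rintro rfl
      apply hs
      intro s hs
      rw [Pi.add_apply, hmw s (Finset.ne_of_mem_erase hs), hσ_eq s (Finset.ne_of_mem_erase hs)]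
      generalize σ y s = u
      revert u; decide
    rw [if_neg hs, if_neg h1, if_neg h2]
    rw [Finset.sum_eq_single ((σ y + m) t)]
    · rw [Function.update_eq_self, hy]; simp
    · intro a _ ha
      simp [Matrix.one_apply_ne ha.symm]
    · simp

end TwoLevel

/-! ### Exact synthesis over Gaussian integers divided by powers of `√2`. -/

section ExactSynthesis
variable {κ : Type} [Fintype κ] [DecidableEq κ] {c : κ}

/-- `z` is a Gaussian integer divided by `√2 ^ k`. -/
def IsGaussianOver (k : ℕ) (z : ℂ) : Prop :=
  ∃ p q : ℤ, z = ((1 / Real.sqrt 2 : ℝ) : ℂ) ^ k * (p + q * Complex.I)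

/-- One step of the reduction of the denominator exponent, on the entries in `S`. -/
lemma exists_reduce_entries (hκ : 3 ≤ Fintype.card κ) (k m : ℕ) :
    ∀ (S : Finset (BasisState {w // w ≠ c})) (ψ : BasisState {w // w ≠ c} → ℂ)
      (p q : BasisState {w // w ≠ c} → ℤ), S.card = m →
      (∀ b ∈ S, ψ b = ((1 / Real.sqrt 2 : ℝ) : ℂ) ^ (k + 1) * (p b + q b * Complex.I)) →
      (∀ b ∉ S, IsGaussianOver k (ψ b)) →
      Even (S.filter fun b => Odd (p b + q b)).card →
      ∃ W, ImplClean c (m * (81700 * Fintype.card κ)) W ∧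
        ∀ b, IsGaussianOver k ((W *ᵥ ψ) b) := by
  induction m using Nat.strong_induction_on with
  | _ m ih =>
  intro S ψ p q hm hS hSc hev
  have hr := inv_sqrt_two_sq
  have hω := omega8_eq
  set r : ℂ := ((1 / Real.sqrt 2 : ℝ) : ℂ) with hr_def
  rcases S.eq_empty_or_nonempty with rfl | hne
  · exact ⟨1, implClean_one.mono (Nat.zero_le _), fun b => by
      rw [Matrix.one_mulVec]; exact hSc b (Finset.notMem_empty b)⟩
  -- `p + q` is odd exactly when `p + qi` is not divisible by `1 + i`. Divisible entries are reduced
  -- singly by a phase, the others in pairs by a Hadamard; evenness of their number makes the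
  -- pairing possible.
  by_cases hall : ∀ b ∈ S, Odd (p b + q b)
  · rw [Finset.filter_true_of_mem hall] at hev
    obtain ⟨b, hb⟩ := hne
    obtain ⟨b', hb'⟩ : (S.erase b).Nonempty := by
      rw [← Finset.card_pos, Finset.card_erase_of_mem hb]
      have := Finset.card_pos.2 ⟨b, hb⟩
      rcases hev with ⟨j, hj⟩
      omega
    have hbb : b' ≠ b := Finset.ne_of_mem_erase hb'
    have hb'S := Finset.mem_of_mem_erase hb'
    -- Multiplication by 1 or `i = omega8 ^ 2` makes the numerator congruent to 1 modulo 2. Sum and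
    -- difference of two such numerators are divisible by 2, and `r * r * 2 = 1` lowers the exponent
    -- from `k + 1` to `k` after the Hadamard.
    have hphase : ∀ b ∈ S, ∃ (e : ℕ) (u v : ℤ), e ≤ 2 ∧
        omega8 ^ e * ψ b = r ^ (k + 1) * ((2 * u + 1 : ℤ) + (2 * v : ℤ) * Complex.I) := by
      intro b hb
      have hbo := hall b hb
      rcases Int.even_or_odd' (q b) with ⟨v, hv | hv⟩
      · have : Odd (p b) := by rw [hv] at hbo; exact (Int.odd_add.1 hbo).2 (even_two_mul v)
        obtain ⟨u, hu⟩ := this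
        refine ⟨0, u, v, by norm_num, ?_⟩
        rw [pow_zero, one_mul, hS b hb, hu, hv]
      · have : Even (p b) := by
          rw [Int.odd_add'] at hbo
          exact hbo.1 ⟨v, hv⟩
        obtain ⟨u, hu⟩ := this.two_dvd
        refine ⟨2, -v - 1, u, by norm_num, ?_⟩
        rw [omega8_sq, hS b hb, hu, hv]
        push_cast
        linear_combination r ^ (k + 1) * (2 * v + 1) * Complex.I_sq
    obtain ⟨e, u, v, he, h1⟩ := hphase b hb
    obtain ⟨e', u', v', he', h2⟩ := hphase b' hb'S
    obtain ⟨V, hV, hVψ⟩ := exists_implClean_hadamard_pair hκ hbb.symm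
    simp only [← hr_def] at hVψ
    have hP := implClean_phase hκ b e
    have hP' := implClean_phase hκ b' e'
    set ψ' : BasisState {w // w ≠ c} → ℂ := V *ᵥ
      ((Matrix.diagonal fun y => if y = b' then omega8 ^ e' else 1) *ᵥ
      ((Matrix.diagonal fun y => if y = b then omega8 ^ e else 1) *ᵥ ψ)) with hψ'
    have hcard : ((S.erase b).erase b').card = m - 2 := by
      rw [Finset.card_erase_of_mem hb', Finset.card_erase_of_mem hb, hm]; rfl
    have hm2 : 2 ≤ m := by
      have := Finset.card_pos.2 ⟨b', hb'⟩
      rw [Finset.card_erase_of_mem hb] at this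
      omega
    have hval : ∀ y, ψ' y = if y = b then r * (omega8 ^ e * ψ b + omega8 ^ e' * ψ b') else
        if y = b' then r * (omega8 ^ e * ψ b - omega8 ^ e' * ψ b') else ψ y := by
      intro y
      rw [hψ', hVψ]
      simp only [Matrix.mulVec_diagonal, hbb, hbb.symm, if_true, if_false, one_mul]
      split_ifs <;> simp
    obtain ⟨W, hW, hWψ⟩ := ih (m - 2) (by omega) ((S.erase b).erase b') ψ' p q hcard
      (by
        intro y hy
        have hy1 := Finset.ne_of_mem_erase hy
        have hy2 := Finset.mem_of_mem_erase hy
        rw [hval, if_neg (Finset.ne_of_mem_erase hy2), if_neg hy1]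
        exact hS y (Finset.mem_of_mem_erase hy2))
      (by
        intro y hy
        rw [hval]
        split_ifs with hyb hyb'
        · refine ⟨u + u' + 1, v + v', ?_⟩
          rw [← hr_def, h1, h2]
          push_cast
          linear_combination r ^ k * (2 * (u + u' + 1) + 2 * (v + v') * Complex.I) * hr
        · refine ⟨u - u', v - v', ?_⟩
          rw [← hr_def, h1, h2]
          push_cast
          linear_combination r ^ k * (2 * (u - u') + 2 * (v - v') * Complex.I) * hr
        · refine hSc y fun h => hy ?_
          simp [hyb, hyb', h])
      (by
        rw [Finset.filter_true_of_mem fun y hy =>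
          hall y (Finset.mem_of_mem_erase (Finset.mem_of_mem_erase hy)), hcard]
        rw [hm] at hev
        exact (Nat.even_sub hm2).2 (by simp [hev]))
    refine ⟨W * V * (Matrix.diagonal fun y => if y = b' then omega8 ^ e' else 1) *
      (Matrix.diagonal fun y => if y = b then omega8 ^ e else 1),
      (((hW.mul hV).mul hP').mul hP).mono ?_, ?_⟩
    · obtain ⟨j, rfl⟩ : ∃ j, m = j + 2 := ⟨m - 2, by omega⟩
      rw [Nat.add_sub_cancel, add_mul j]
      have h3 : (e + 1) * (10200 * Fintype.card κ) ≤ 3 * (10200 * Fintype.card κ) := by gcongr; omega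
      have h4 : (e' + 1) * (10200 * Fintype.card κ) ≤ 3 * (10200 * Fintype.card κ) := by
        gcongr; omega
      omega
    · intro y
      simp only [← Matrix.mulVec_mulVec]
      exact hWψ y
  · push Not at hall
    obtain ⟨b, hb, hbo⟩ := hall
    rw [Int.not_odd_iff_even] at hbo
    obtain ⟨u, hu⟩ := hbo.two_dvd
    -- As `omega8 = r * (1 + i)`, the phase `omega8 ^ 7` divides by `1 + i` at the price of one
    -- factor `r`.
    have hP := implClean_phase hκ b 7
    set ψ' : BasisState {w // w ≠ c} → ℂ :=
      (Matrix.diagonal fun y => if y = b then omega8 ^ 7 else 1) *ᵥ ψ with hψ'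
    have hval : ∀ y, ψ' y = if y = b then omega8 ^ 7 * ψ b else ψ y := by
      intro y
      rw [hψ', Matrix.mulVec_diagonal]
      split_ifs with h
      · rw [h]
      · rw [one_mul]
    have hcard : (S.erase b).card = m - 1 := by rw [Finset.card_erase_of_mem hb, hm]
    have hm1 : 1 ≤ m := by rw [← hm]; exact Finset.card_pos.2 ⟨b, hb⟩
    obtain ⟨W, hW, hWψ⟩ := ih (m - 1) (by omega) (S.erase b) ψ' p q hcard
      (by
        intro y hy
        rw [hval, if_neg (Finset.ne_of_mem_erase hy)]
        exact hS y (Finset.mem_of_mem_erase hy))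
      (by
        intro y hy
        rw [hval]
        split_ifs with hyb
        · refine ⟨u, u - p b, ?_⟩
          rw [← hr_def, hS b hb]
          have hq : (q b : ℂ) = 2 * u - p b := by
            rw [eq_sub_iff_add_eq', ← Int.cast_add, hu]; push_cast; ring
          have h8 := omega8_pow_eight
          rw [hq]
          push_cast
          have h3 : omega8 ^ 7 * r * (1 + Complex.I) = 1 := by
            linear_combination h8 - omega8 ^ 7 * hω
          linear_combination r ^ k * (u + (u - p b) * Complex.I) * h3
            - omega8 ^ 7 * r ^ (k + 1) * (u - p b) * Complex.I_sq
        · exact hSc y fun h => hy (by simp [hyb, h]))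
      (by
        convert hev using 2
        ext y
        simp only [Finset.mem_filter, Finset.mem_erase]
        constructor
        · rintro ⟨⟨-, h⟩, h'⟩; exact ⟨h, h'⟩
        · rintro ⟨h, h'⟩
          refine ⟨⟨?_, h⟩, h'⟩
          rintro rfl
          exact Int.not_odd_iff_even.2 hbo h')
    refine ⟨W * (Matrix.diagonal fun y => if y = b then omega8 ^ 7 else 1),
      (hW.mul hP).mono ?_, ?_⟩
    · obtain ⟨j, rfl⟩ : ∃ j, m = j + 1 := ⟨m - 1, by omega⟩
      rw [Nat.add_sub_cancel, add_mul j]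
      omega
    · intro y
      rw [← Matrix.mulVec_mulVec]
      exact hWψ y

lemma dotProduct_star_mulVec {α : Type} [Fintype α] [DecidableEq α] {W : Matrix α α ℂ}
    (hW : Wᴴ * W = 1) (ψ : α → ℂ) : star (W *ᵥ ψ) ⬝ᵥ (W *ᵥ ψ) = star ψ ⬝ᵥ ψ := by
  rw [Matrix.star_mulVec, Matrix.dotProduct_mulVec, Matrix.vecMul_vecMul, hW, Matrix.vecMul_one]

lemma gaussian_sq_sum {α : Type} [Fintype α] {ψ : α → ℂ} {k : ℕ} {p q : α → ℤ}
    (h : ∀ b, ψ b = ((1 / Real.sqrt 2 : ℝ) : ℂ) ^ k * (p b + q b * Complex.I))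
    (hψ : star ψ ⬝ᵥ ψ = 1) : ∑ b, ((p b).natAbs ^ 2 + (q b).natAbs ^ 2) = 2 ^ k := by
  have h1 : ∀ b, star (ψ b) * ψ b = (1 / 2) ^ k * ((p b : ℂ) ^ 2 + (q b : ℂ) ^ 2) := by
    intro b
    rw [h b]
    simp only [star_mul', star_pow, star_add, Complex.star_def, Complex.conj_ofReal,
      Complex.conj_I, map_intCast]
    rw [← inv_sqrt_two_sq]
    linear_combination -(((1 / Real.sqrt 2 : ℝ) : ℂ) ^ k) ^ 2 * (q b : ℂ) ^ 2 * Complex.I_sq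
  have h2 : (∑ b, ((p b : ℂ) ^ 2 + (q b : ℂ) ^ 2)) = 2 ^ k := by
    have h3 : (1 / 2 : ℂ) ^ k * (∑ b, ((p b : ℂ) ^ 2 + (q b : ℂ) ^ 2)) = 1 := by
      rw [Finset.mul_sum]
      exact (Finset.sum_congr rfl fun b _ => (h1 b).symm).trans hψ
    have h4 : (2 : ℂ) ^ k * (1 / 2) ^ k = 1 := by rw [← mul_pow]; norm_num
    linear_combination (2 : ℂ) ^ k * h3 - (∑ b, ((p b : ℂ) ^ 2 + (q b : ℂ) ^ 2)) * h4
  have h5 : (∑ b, ((p b) ^ 2 + (q b) ^ 2)) = 2 ^ k := by exact_mod_cast h2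
  zify
  simpa using h5

/-- Each round removes one factor `√2` from the denominators. At exponent 0 the squared integer
parts sum to 1, so a single entry survives. -/
lemma exists_implClean_reduce (hκ : 3 ≤ Fintype.card κ) (k : ℕ) :
    ∀ ψ : BasisState {w // w ≠ c} → ℂ, (∀ b, IsGaussianOver k (ψ b)) → star ψ ⬝ᵥ ψ = 1 →
      ∃ W, ImplClean c (k * (Fintype.card (BasisState {w // w ≠ c}) *
          (81700 * Fintype.card κ))) W ∧
        ∃ b, ∀ y, y ≠ b → (W *ᵥ ψ) y = 0 := by
  induction k with
  | zero =>
    intro ψ hψ hn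
    refine ⟨1, implClean_one.mono (Nat.zero_le _), ?_⟩
    rw [Matrix.one_mulVec]
    choose p q h using hψ
    have hs := gaussian_sq_sum h hn
    rw [pow_zero] at hs
    obtain ⟨b, -, hb⟩ : ∃ b ∈ Finset.univ, (p b).natAbs ^ 2 + (q b).natAbs ^ 2 ≠ 0 := by
      apply Finset.exists_ne_zero_of_sum_ne_zero
      rw [hs]; norm_num
    refine ⟨b, fun y hy => ?_⟩
    have h2 := Finset.sum_le_sum_of_subset (f := fun b => (p b).natAbs ^ 2 + (q b).natAbs ^ 2)
      (Finset.subset_univ {y, b})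
    rw [hs, Finset.sum_pair hy] at h2
    have h3 : (p y).natAbs ^ 2 + (q y).natAbs ^ 2 = 0 := by omega
    have h4 : p y = 0 ∧ q y = 0 := by
      simpa using h3
    rw [h y, h4.1, h4.2]
    simp
  | succ k ih =>
    intro ψ hψ hn
    choose p q h using hψ
    have hs := gaussian_sq_sum h hn
    -- The norm condition makes the sum of all `p² + q²` equal to `2 ^ (k + 1)`, which is even, and
    -- `p² + q²` has the parity of `p + q`.
    have hev : Even (Finset.univ.filter fun b => Odd (p b + q b)).card := by
      have : Even (∑ b, ((p b).natAbs ^ 2 + (q b).natAbs ^ 2)) := by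
        rw [hs, pow_succ]; exact even_two.mul_left _
      rw [Finset.even_sum_iff_even_card_odd] at this
      convert this using 4 with b
      rw [Nat.odd_add, Nat.odd_pow_iff (by norm_num), Nat.even_pow' (by norm_num),
        Int.natAbs_odd, Int.natAbs_even, Int.odd_add]
    obtain ⟨V, hV, hVψ⟩ := exists_reduce_entries hκ k _ Finset.univ ψ p q rfl
      (fun b _ => h b) (fun b hb => absurd (Finset.mem_univ b) hb) hev
    obtain ⟨W, hW, b, hb⟩ := ih (V *ᵥ ψ) hVψ
      (by rw [dotProduct_star_mulVec hV.conjTranspose_mul, hn])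
    refine ⟨W * V, (hW.mul hV).mono ?_, b, ?_⟩
    · rw [add_mul k, one_mul, Finset.card_univ]
    · rwa [← Matrix.mulVec_mulVec]

/-- The reflection in the hyperplane orthogonal to the unit vector `ψ`. -/
noncomputable def reflectionMatrix {α : Type} [DecidableEq α] (ψ : α → ℂ) : Matrix α α ℂ :=
  1 - (2 : ℂ) • Matrix.vecMulVec ψ (star ψ)

lemma mul_reflectionMatrix_mul {α : Type} [Fintype α] [DecidableEq α] {W : Matrix α α ℂ}
    (hW : Wᴴ * W = 1) (ψ : α → ℂ) :
    Wᴴ * reflectionMatrix (W *ᵥ ψ) * W = reflectionMatrix ψ := by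
  have h : Matrix.vecMulVec (W *ᵥ ψ) (star (W *ᵥ ψ)) = W * Matrix.vecMulVec ψ (star ψ) * Wᴴ := by
    rw [Matrix.mul_vecMulVec, Matrix.vecMulVec_mul, Matrix.star_mulVec]
  rw [reflectionMatrix, reflectionMatrix, h, Matrix.mul_sub, Matrix.sub_mul, Matrix.mul_one, hW,
    Matrix.mul_smul, Matrix.smul_mul]
  congr 2
  calc _ = (Wᴴ * W) * Matrix.vecMulVec ψ (star ψ) * (Wᴴ * W) := by simp only [Matrix.mul_assoc]
    _ = _ := by rw [hW, Matrix.one_mul, Matrix.mul_one]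

/-- Exact synthesis of the reflection in a unit vector over the Gaussian integers with
denominator `√2 ^ k`. -/
lemma implClean_reflectionMatrix (hκ : 3 ≤ Fintype.card κ) {k : ℕ}
    {ψ : BasisState {w // w ≠ c} → ℂ} (h : ∀ b, IsGaussianOver k (ψ b))
    (hψ : star ψ ⬝ᵥ ψ = 1) :
    ImplClean c ((8 * k + 1) * (Fintype.card (BasisState {w // w ≠ c}) *
          (81700 * Fintype.card κ))) (reflectionMatrix ψ) := by
  obtain ⟨W, hW, b, hb⟩ := exists_implClean_reduce hκ k ψ h hψ
  have hWW := hW.conjTranspose_mul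
  -- `W *ᵥ ψ` is a phase times the basis vector at `b`, and the phase drops out of the reflection:
  -- what remains is the sign `omega8 ^ 4` at `b`. The factor 8 is 7 for `Wᴴ` plus 1 for `W`.
  refine ((hW.conjTranspose.mul (implClean_phase hκ b 4)).mul hW).congr ?_ ?_
  · have : 1 * (4 + 1) * (10200 * Fintype.card κ) ≤
        Fintype.card (BasisState {w // w ≠ c}) * (81700 * Fintype.card κ) := by
      rw [mul_assoc]
      apply Nat.mul_le_mul
      · exact Fintype.card_pos_iff.2 ⟨b⟩
      · omega
    rw [add_mul (8 * k), mul_assoc 8 k]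
    omega
  · rw [← mul_reflectionMatrix_mul hWW]
    congr 2
    have h1 : star ((W *ᵥ ψ) b) * (W *ᵥ ψ) b = 1 := by
      rw [← hψ, ← dotProduct_star_mulVec hWW, dotProduct, Finset.sum_eq_single b]
      · rfl
      · intro y _ hy; rw [hb y hy, mul_zero]
      · simp
    ext x y
    rw [Matrix.diagonal_apply, reflectionMatrix, Matrix.sub_apply, Matrix.smul_apply,
      Matrix.vecMulVec_apply, Matrix.one_apply, omega8_pow_four, Pi.star_apply, smul_eq_mul]
    by_cases hxy : x = y
    · subst hxy
      by_cases hx : x = b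
      · subst hx
        simp only [if_true]
        linear_combination 2 * h1
      · simp [hb x hx, hx]
    · rw [if_neg hxy, if_neg hxy]
      by_cases hx : x = b
      · have hy : y ≠ b := fun h => hxy (hx.trans h.symm)
        simp [hb y hy]
      · simp [hb x hx]

end ExactSynthesis

/-! ### Rounding unit vectors with exact norm. -/

section Approximation

/-- Rounding is towards zero: squares never grow, so the norm left over is nonnegative, and zero
entries stay zero. -/
lemma exists_int_truncation (x : ℝ) : ∃ t : ℤ, (x - t) ^ 2 ≤ 1 ∧ (t : ℝ) ^ 2 ≤ x ^ 2 ∧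
    x ^ 2 - (t : ℝ) ^ 2 ≤ 2 * |x| ∧ (x = 0 → t = 0) := by
  have hf := Int.floor_le |x|
  have hf' := (Int.lt_floor_add_one |x|).le
  have hf0 : (0 : ℝ) ≤ ⌊|x|⌋ := by exact_mod_cast Int.floor_nonneg.2 (abs_nonneg x)
  have h2 : (⌊|x|⌋ : ℝ) ^ 2 ≤ x ^ 2 := by rw [← sq_abs x]; gcongr
  have h3 : x ^ 2 - (⌊|x|⌋ : ℝ) ^ 2 ≤ 2 * |x| := by
    rw [← sq_abs x]; nlinarith
  rcases le_total 0 x with h | h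
  · refine ⟨⌊|x|⌋, ?_, h2, h3, fun h => by simp [h]⟩
    rw [abs_of_nonneg h] at *
    nlinarith
  · refine ⟨-⌊|x|⌋, ?_, by simpa using h2, by simpa using h3, fun h => by simp [h]⟩
    rw [abs_of_nonpos h] at *
    push_cast
    nlinarith

variable {α : Type} [Fintype α] [DecidableEq α]

lemma dotProduct_star_eq (ψ : α → ℂ) : star ψ ⬝ᵥ ψ = ((∑ b, ‖ψ b‖ ^ 2 : ℝ) : ℂ) := by
  rw [dotProduct, Complex.ofReal_sum]
  refine Finset.sum_congr rfl fun b _ => ?_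
  rw [Pi.star_apply, Complex.star_def, ← Complex.normSq_eq_conj_mul_self, Complex.normSq_eq_norm_sq]

lemma dotProduct_star_eq_one_iff (ψ : α → ℂ) : star ψ ⬝ᵥ ψ = 1 ↔ ∑ b, ‖ψ b‖ ^ 2 = 1 := by
  rw [dotProduct_star_eq]; norm_cast

/-- A unit vector with two zero entries is close to a unit vector over the Gaussian integers with
denominator `2 ^ K`; the two entries absorb the rounding error by the four squares theorem. -/
lemma exists_gaussian_approx {v : α → ℂ} (hv : star v ⬝ᵥ v = 1) {p q : α} (hpq : p ≠ q)
    (hp : v p = 0) (hq : v q = 0) (K : ℕ) :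
    ∃ ψ : α → ℂ, (∀ b, IsGaussianOver (2 * K) (ψ b)) ∧ star ψ ⬝ᵥ ψ = 1 ∧
      ∑ b, ‖v b - ψ b‖ ^ 2 ≤ 6 * Fintype.card α / 2 ^ K := by
  rw [dotProduct_star_eq_one_iff] at hv
  have hv1 : ∀ b, ‖v b‖ ≤ 1 := by
    intro b
    have := Finset.single_le_sum (f := fun b => ‖v b‖ ^ 2) (fun b _ => sq_nonneg _)
      (Finset.mem_univ b)
    rw [hv] at this
    exact (sq_le_one_iff₀ (norm_nonneg _)).1 this
  choose t ht1 ht2 ht3 ht4 using fun b => exists_int_truncation (2 ^ K * (v b).re)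
  choose s hs1 hs2 hs3 hs4 using fun b => exists_int_truncation (2 ^ K * (v b).im)
  have hsq : ∑ b, ((2 ^ K * (v b).re) ^ 2 + (2 ^ K * (v b).im) ^ 2) = (4 : ℝ) ^ K := by
    have : ∀ b, (2 ^ K * (v b).re) ^ 2 + (2 ^ K * (v b).im) ^ 2 = 4 ^ K * ‖v b‖ ^ 2 := by
      intro b
      rw [← Complex.normSq_eq_norm_sq, Complex.normSq_apply,
        show (4 : ℝ) ^ K = (2 ^ K) ^ 2 by rw [← pow_mul, mul_comm, pow_mul]; norm_num]
      ring
    simp only [this, ← Finset.mul_sum, hv, mul_one]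
  have hle : ∑ b, (t b ^ 2 + s b ^ 2) ≤ 4 ^ K := by
    have : (∑ b, ((t b : ℝ) ^ 2 + (s b : ℝ) ^ 2)) ≤ 4 ^ K := by
      rw [← hsq]
      exact Finset.sum_le_sum fun b _ => add_le_add (ht2 b) (hs2 b)
    exact_mod_cast this
  -- Lagrange's theorem applied to the norm lost by truncation; `x₁ + x₂ i` goes to entry `p` and
  -- `x₃ + x₄ i` to entry `q`.
  obtain ⟨x₁, x₂, x₃, x₄, hx⟩ := Nat.sum_four_squares (4 ^ K - ∑ b, (t b ^ 2 + s b ^ 2)).toNat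
  have hx' : (x₁ : ℤ) ^ 2 + (x₂ : ℤ) ^ 2 + ((x₃ : ℤ) ^ 2 + (x₄ : ℤ) ^ 2) =
      4 ^ K - ∑ b, (t b ^ 2 + s b ^ 2) := by
    rw [← Int.toNat_of_nonneg (sub_nonneg.2 hle), ← hx]
    push_cast; ring
  have htp : t p = 0 := ht4 p (by simp [hp])
  have hsp : s p = 0 := hs4 p (by simp [hp])
  have htq : t q = 0 := ht4 q (by simp [hq])
  have hsq' : s q = 0 := hs4 q (by simp [hq])
  set P : α → ℤ := fun b => if b = p then (x₁ : ℤ) else if b = q then (x₃ : ℤ) else t b with hP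
  set Q : α → ℤ := fun b => if b = p then (x₂ : ℤ) else if b = q then (x₄ : ℤ) else s b with hQ
  set g : α → ℤ := fun b => (if b = p then (x₁ : ℤ) ^ 2 + (x₂ : ℤ) ^ 2 else 0) +
    if b = q then (x₃ : ℤ) ^ 2 + (x₄ : ℤ) ^ 2 else 0 with hg
  have hPQ : ∀ b, P b ^ 2 + Q b ^ 2 = t b ^ 2 + s b ^ 2 + g b := by
    intro b
    by_cases hbp : b = p
    · subst hbp; simp [hP, hQ, hg, htp, hsp, hpq]
    · by_cases hbq : b = q
      · subst hbq; simp [hP, hQ, hg, htq, hsq', hpq.symm]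
      · simp [hP, hQ, hg, hbp, hbq]
  have hgsum : ∑ b, g b = 4 ^ K - ∑ b, (t b ^ 2 + s b ^ 2) := by
    rw [← hx']
    simp [hg, Finset.sum_add_distrib]
  have hPQsum : ∑ b, (P b ^ 2 + Q b ^ 2) = 4 ^ K := by
    simp only [hPQ]
    rw [Finset.sum_add_distrib, hgsum]
    ring
  have herr : ∀ b, (2 ^ K * (v b).re - P b) ^ 2 + (2 ^ K * (v b).im - Q b) ^ 2 ≤
      2 + (g b : ℝ) := by
    intro b
    by_cases hbp : b = p
    · subst hbp; simp [hP, hQ, hg, hp, hpq]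
    · by_cases hbq : b = q
      · subst hbq; simp [hP, hQ, hg, hq, hpq.symm]
      · simp only [hP, hQ, hg, hbp, hbq, if_false]
        have := ht1 b
        have := hs1 b
        push_cast
        linarith
  -- Each of the two coordinates of an entry loses at most `2 * 2 ^ K` in its square. With the
  -- truncation error of at most 2 per entry this yields the constant 6 after division by `4 ^ K`.
  have hg_le : ∑ b, (g b : ℝ) ≤ 4 * 2 ^ K * Fintype.card α := by
    have h1 : ∑ b, (g b : ℝ) = ∑ b, (((2 ^ K * (v b).re) ^ 2 - (t b : ℝ) ^ 2) +
        ((2 ^ K * (v b).im) ^ 2 - (s b : ℝ) ^ 2)) := by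
      have : ∑ b, (g b : ℝ) = 4 ^ K - ∑ b, ((t b : ℝ) ^ 2 + (s b : ℝ) ^ 2) := by
        exact_mod_cast hgsum
      rw [this, ← hsq, ← Finset.sum_sub_distrib]
      exact Finset.sum_congr rfl fun b _ => by ring
    rw [h1]
    have h2 : ∀ b ∈ Finset.univ, ((2 ^ K * (v b).re) ^ 2 - (t b : ℝ) ^ 2) +
        ((2 ^ K * (v b).im) ^ 2 - (s b : ℝ) ^ 2) ≤ 4 * 2 ^ K := by
      intro b _
      have h3 := ht3 b
      have h4 := hs3 b
      rw [abs_mul, abs_of_pos (by positivity : (0 : ℝ) < 2 ^ K)] at h3 h4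
      have h5 := mul_le_mul_of_nonneg_left ((Complex.abs_re_le_norm (v b)).trans (hv1 b))
        (by positivity : (0 : ℝ) ≤ 2 ^ K)
      have h6 := mul_le_mul_of_nonneg_left ((Complex.abs_im_le_norm (v b)).trans (hv1 b))
        (by positivity : (0 : ℝ) ≤ 2 ^ K)
      linarith
    refine (Finset.sum_le_card_nsmul _ _ _ h2).trans ?_
    rw [nsmul_eq_mul, Finset.card_univ, mul_comm]
  have h42 : (4 : ℝ) ^ K = (2 ^ K) ^ 2 := by rw [← pow_mul, mul_comm, pow_mul]; norm_num
  have hK : (0 : ℝ) < 2 ^ K := by positivity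
  have hnorm : ∀ x y : ℝ, ‖(x + y * Complex.I : ℂ)‖ ^ 2 = x ^ 2 + y ^ 2 := by
    intro x y
    rw [← Complex.normSq_eq_norm_sq, Complex.normSq_add_mul_I]
  refine ⟨fun b => ((P b / 2 ^ K : ℝ) : ℂ) + ((Q b / 2 ^ K : ℝ) : ℂ) * Complex.I, ?_, ?_, ?_⟩
  · intro b
    refine ⟨P b, Q b, ?_⟩
    rw [pow_mul, inv_sqrt_two_sq]
    push_cast
    rw [div_pow, one_pow]
    ring
  · rw [dotProduct_star_eq_one_iff]
    simp only [hnorm, div_pow, ← add_div, ← Finset.sum_div]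
    rw [div_eq_one_iff_eq (by positivity), ← h42]
    exact_mod_cast hPQsum
  · have h1 : ∀ b, ‖v b - (((P b / 2 ^ K : ℝ) : ℂ) + ((Q b / 2 ^ K : ℝ) : ℂ) * Complex.I)‖ ^ 2 =
        ((2 ^ K * (v b).re - P b) ^ 2 + (2 ^ K * (v b).im - Q b) ^ 2) / (2 ^ K) ^ 2 := by
      intro b
      have : v b - (((P b / 2 ^ K : ℝ) : ℂ) + ((Q b / 2 ^ K : ℝ) : ℂ) * Complex.I) =
          (((v b).re - P b / 2 ^ K : ℝ) : ℂ) + (((v b).im - Q b / 2 ^ K : ℝ) : ℂ) * Complex.I := by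
        conv_lhs => rw [← Complex.re_add_im (v b)]
        push_cast; ring
      rw [this, hnorm]
      field_simp
    simp only [h1, ← Finset.sum_div]
    rw [div_le_div_iff₀ (by positivity) hK]
    have h2 := Finset.sum_le_sum fun b (_ : b ∈ Finset.univ) => herr b
    have h2' : ∑ b, (2 + (g b : ℝ)) = Fintype.card α * 2 + ∑ b, (g b : ℝ) := by
      rw [Finset.sum_add_distrib, Finset.sum_const, Finset.card_univ, nsmul_eq_mul]
    rw [h2'] at h2
    have h3 : (1 : ℝ) ≤ 2 ^ K := one_le_pow₀ (by norm_num)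
    have h4 : (0 : ℝ) ≤ Fintype.card α := Nat.cast_nonneg _
    have h5 : ∑ b, ((2 ^ K * (v b).re - P b) ^ 2 + (2 ^ K * (v b).im - Q b) ^ 2) ≤
        (6 * Fintype.card α * 2 ^ K : ℝ) := by nlinarith
    calc _ ≤ (6 * Fintype.card α * 2 ^ K * 2 ^ K : ℝ) := by gcongr
      _ = _ := by ring

end Approximation

/-! ### Algebra of reflections. -/

section Reflection
variable {α : Type} [Fintype α] [DecidableEq α]

lemma reflectionMatrix_conjTranspose (ψ : α → ℂ) :
    (reflectionMatrix ψ)ᴴ = reflectionMatrix ψ := by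
  ext x y
  simp only [reflectionMatrix, Matrix.conjTranspose_apply, Matrix.sub_apply, Matrix.smul_apply,
    Matrix.vecMulVec_apply, smul_eq_mul, Pi.star_apply, star_sub, star_mul', star_star,
    Matrix.one_apply, @eq_comm _ y x]
  split_ifs <;> simp [mul_comm]

lemma reflectionMatrix_mulVec (ψ x : α → ℂ) :
    reflectionMatrix ψ *ᵥ x = x - (2 * (star ψ ⬝ᵥ x)) • ψ := by
  rw [reflectionMatrix, Matrix.sub_mulVec, Matrix.one_mulVec, Matrix.smul_mulVec,
    Matrix.vecMulVec_mulVec, op_smul_eq_smul, smul_smul]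

lemma reflectionMatrix_mul_self {ψ : α → ℂ} (hψ : star ψ ⬝ᵥ ψ = 1) :
    reflectionMatrix ψ * reflectionMatrix ψ = 1 := by
  have h : Matrix.vecMulVec ψ (star ψ) * Matrix.vecMulVec ψ (star ψ) =
      Matrix.vecMulVec ψ (star ψ) := by
    rw [Matrix.mul_vecMulVec, Matrix.vecMulVec_mulVec, hψ]; simp
  simp only [reflectionMatrix, Matrix.mul_sub, Matrix.sub_mul, Matrix.mul_one, Matrix.one_mul,
    Matrix.smul_mul, Matrix.mul_smul, h]
  module

end Reflection

/-! ### Frobenius distance and its invariance under isometries. -/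

section Frobenius
variable {l m k : Type} [Fintype l] [Fintype m] [Fintype k]

lemma frobeniusDist_eq (A B : Matrix l m ℂ) :
    frobeniusDist A B = Real.sqrt (∑ i, ∑ j, ‖A i j - B i j‖ ^ 2) := by
  let _ : NormedAddCommGroup (Matrix l m ℂ) := Matrix.frobeniusNormedAddCommGroup
  change ‖A - B‖ = _
  rw [Matrix.frobenius_norm_def, Real.sqrt_eq_rpow]
  simp

lemma frobeniusDist_triangle (A B C : Matrix l m ℂ) :
    frobeniusDist A C ≤ frobeniusDist A B + frobeniusDist B C := by
  let _ : NormedAddCommGroup (Matrix l m ℂ) := Matrix.frobeniusNormedAddCommGroup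
  exact norm_sub_le_norm_sub_add_norm_sub A B C

lemma frobeniusDist_comm (A B : Matrix l m ℂ) : frobeniusDist A B = frobeniusDist B A := by
  rw [frobeniusDist_eq, frobeniusDist_eq]
  simp only [norm_sub_rev]

lemma frobeniusDist_self (A : Matrix l m ℂ) : frobeniusDist A A = 0 := by
  rw [frobeniusDist_eq]; simp

lemma trace_conjTranspose_mul_eq (A : Matrix l m ℂ) :
    (Aᴴ * A).trace = ((∑ i, ∑ j, ‖A i j‖ ^ 2 : ℝ) : ℂ) := by
  rw [Matrix.trace, Finset.sum_comm, Complex.ofReal_sum]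
  refine Finset.sum_congr rfl fun j _ => ?_
  rw [Matrix.diag_apply, Matrix.mul_apply, Complex.ofReal_sum]
  refine Finset.sum_congr rfl fun i _ => ?_
  rw [Matrix.conjTranspose_apply, Complex.star_def, ← Complex.normSq_eq_conj_mul_self,
    Complex.normSq_eq_norm_sq]

lemma frobeniusDist_mul_left [DecidableEq m] {W : Matrix l m ℂ} (hW : Wᴴ * W = 1)
    (A B : Matrix m k ℂ) : frobeniusDist (W * A) (W * B) = frobeniusDist A B := by
  rw [frobeniusDist_eq, frobeniusDist_eq]
  congr 1
  have h : ((W * (A - B))ᴴ * (W * (A - B))).trace = ((A - B)ᴴ * (A - B)).trace := by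
    rw [Matrix.conjTranspose_mul, Matrix.mul_assoc, ← Matrix.mul_assoc Wᴴ, hW, Matrix.one_mul]
  rw [trace_conjTranspose_mul_eq, trace_conjTranspose_mul_eq, Matrix.mul_sub] at h
  exact_mod_cast h

lemma frobeniusDist_conjTranspose (A B : Matrix l m ℂ) :
    frobeniusDist Aᴴ Bᴴ = frobeniusDist A B := by
  rw [frobeniusDist_eq, frobeniusDist_eq, Finset.sum_comm]
  simp only [Matrix.conjTranspose_apply, ← star_sub, norm_star]

lemma frobeniusDist_mul_right [DecidableEq m] {W : Matrix m l ℂ} (hW : W * Wᴴ = 1)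
    (A B : Matrix k m ℂ) : frobeniusDist (A * W) (B * W) = frobeniusDist A B := by
  rw [← frobeniusDist_conjTranspose, Matrix.conjTranspose_mul, Matrix.conjTranspose_mul,
    frobeniusDist_mul_left (by rwa [Matrix.conjTranspose_conjTranspose]),
    frobeniusDist_conjTranspose]

/-- Write `uu* - vv* = (u - v)u* + v(u - v)*`; a rank-one matrix has as Frobenius norm the product
of the two vector norms. -/
lemma frobeniusDist_reflectionMatrix [DecidableEq l] {u v : l → ℂ} (hu : star u ⬝ᵥ u = 1)
    (hv : star v ⬝ᵥ v = 1) :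
    frobeniusDist (reflectionMatrix u) (reflectionMatrix v) ≤
      4 * Real.sqrt (∑ b, ‖u b - v b‖ ^ 2) := by
  rw [dotProduct_star_eq_one_iff] at hu hv
  let _ : NormedAddCommGroup (Matrix l l ℂ) := Matrix.frobeniusNormedAddCommGroup
  let _ : NormedSpace ℂ (Matrix l l ℂ) := Matrix.frobeniusNormedSpace
  have hvec : ∀ x y : l → ℂ, ‖Matrix.vecMulVec x (star y)‖ =
      Real.sqrt (∑ b, ‖x b‖ ^ 2) * Real.sqrt (∑ b, ‖y b‖ ^ 2) := by
    intro x y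
    have := frobeniusDist_eq (Matrix.vecMulVec x (star y)) 0
    change ‖Matrix.vecMulVec x (star y) - 0‖ = _ at this
    rw [sub_zero] at this
    rw [this, ← Real.sqrt_mul (Finset.sum_nonneg fun b _ => sq_nonneg _), Finset.sum_mul_sum]
    simp [Matrix.vecMulVec_apply, mul_pow]
  change ‖reflectionMatrix u - reflectionMatrix v‖ ≤ _
  have h : reflectionMatrix u - reflectionMatrix v =
      (-2 : ℂ) • (Matrix.vecMulVec (u - v) (star u) + Matrix.vecMulVec v (star (u - v))) := by
    ext i j
    simp only [reflectionMatrix, Matrix.sub_apply, Matrix.smul_apply, Matrix.add_apply,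
      Matrix.vecMulVec_apply, smul_eq_mul, Pi.sub_apply, Pi.star_apply, star_sub]
    ring
  rw [h, norm_smul]
  have h1 := norm_add_le (Matrix.vecMulVec (u - v) (star u)) (Matrix.vecMulVec v (star (u - v)))
  rw [hvec, hvec, hu, hv, Real.sqrt_one, mul_one, one_mul] at h1
  simp only [Pi.sub_apply] at h1
  have h2 : ‖(-2 : ℂ)‖ = 2 := by simp
  rw [h2]
  linarith

end Frobenius

/-! ### Approximating a product of reflections. -/

section ApproximateReflections
variable {κ : Type} [Fintype κ] [DecidableEq κ] {c : κ}

/-- Approximation of a product of reflections in unit vectors with two zero entries. -/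
lemma exists_implClean_approx_prod (hκ : 3 ≤ Fintype.card κ) (K : ℕ)
    (L : List (BasisState {w // w ≠ c} → ℂ))
    (hL : ∀ v ∈ L, star v ⬝ᵥ v = 1 ∧ ∃ p q, p ≠ q ∧ v p = 0 ∧ v q = 0) :
    ∃ V, ImplClean c (L.length * ((16 * K + 1) * (Fintype.card (BasisState {w // w ≠ c}) *
          (81700 * Fintype.card κ)))) V ∧
      frobeniusDist V (L.map reflectionMatrix).prod ≤
        L.length * (4 * Real.sqrt (6 * Fintype.card (BasisState {w // w ≠ c}) / 2 ^ K)) := by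
  induction L with
  | nil => exact ⟨1, implClean_one.mono (Nat.zero_le _), by simp [frobeniusDist_self]⟩
  | cons v L ih =>
    obtain ⟨V, hV, hVd⟩ := ih fun v hv => hL v (List.mem_cons_of_mem _ hv)
    obtain ⟨hv, p, q, hpq, hp, hq⟩ := hL v List.mem_cons_self
    obtain ⟨ψ, hψ, hψ1, hd⟩ := exists_gaussian_approx hv hpq hp hq K
    have hR := implClean_reflectionMatrix hκ hψ hψ1
    refine ⟨reflectionMatrix ψ * V, (hR.mul hV).mono ?_, ?_⟩
    · rw [List.length_cons, add_mul L.length, one_mul, show 8 * (2 * K) = 16 * K by ring]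
      omega
    · rw [List.map_cons, List.prod_cons, List.length_cons]
      -- One factor is replaced at a time; the remaining factors are unitary, so the errors add
      -- without amplification.
      have h1 := frobeniusDist_triangle (reflectionMatrix ψ * V)
        (reflectionMatrix v * V) (reflectionMatrix v * (L.map reflectionMatrix).prod)
      rw [frobeniusDist_mul_right hV.mul_conjTranspose] at h1
      have h2 : (reflectionMatrix v)ᴴ * reflectionMatrix v = 1 := by
        rw [reflectionMatrix_conjTranspose, reflectionMatrix_mul_self hv]
      rw [frobeniusDist_mul_left h2] at h1
      have h3 := frobeniusDist_reflectionMatrix hv hψ1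
      rw [frobeniusDist_comm] at h3
      have h4 := Real.sqrt_le_sqrt hd
      push_cast
      linarith

end ApproximateReflections

/-! ### Householder reduction of a unitary matrix. -/

section ReflectionDecomposition
variable {α : Type} [Fintype α] [DecidableEq α]

lemma prod_reflectionMatrix_conjTranspose (L : List (α → ℂ)) :
    ((L.map reflectionMatrix).prod)ᴴ = (L.reverse.map reflectionMatrix).prod := by
  induction L with
  | nil => simp
  | cons v L ih =>
    rw [List.map_cons, List.prod_cons, Matrix.conjTranspose_mul, ih,
      reflectionMatrix_conjTranspose]
    simp

lemma prod_reflectionMatrix_conjTranspose_mul (L : List (α → ℂ))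
    (hL : ∀ v ∈ L, star v ⬝ᵥ v = 1) :
    ((L.map reflectionMatrix).prod)ᴴ * (L.map reflectionMatrix).prod = 1 := by
  induction L with
  | nil => simp
  | cons v L ih =>
    rw [List.map_cons, List.prod_cons, Matrix.conjTranspose_mul, Matrix.mul_assoc,
      ← Matrix.mul_assoc _ (reflectionMatrix v), reflectionMatrix_conjTranspose,
      reflectionMatrix_mul_self (hL v List.mem_cons_self), Matrix.one_mul,
      ih fun v hv => hL v (List.mem_cons_of_mem _ hv)]

/-- At most one reflection swaps two unit vectors whose inner product is real. -/
lemma exists_reflection_swap {u v : α → ℂ} (hu : star u ⬝ᵥ u = 1) (hv : star v ⬝ᵥ v = 1)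
    (huv : star u ⬝ᵥ v = star v ⬝ᵥ u) :
    ∃ L : List (α → ℂ), L.length ≤ 1 ∧
      (∀ w ∈ L, star w ⬝ᵥ w = 1 ∧ ∀ b, u b = 0 → v b = 0 → w b = 0) ∧
      (L.map reflectionMatrix).prod *ᵥ u = v ∧ (L.map reflectionMatrix).prod *ᵥ v = u ∧
      ∀ x, star u ⬝ᵥ x = 0 → star v ⬝ᵥ x = 0 → (L.map reflectionMatrix).prod *ᵥ x = x := by
  by_cases h : u = v
  · subst h
    exact ⟨[], by simp, by simp, by simp, by simp, by simp⟩
  set s : ℂ := star u ⬝ᵥ v with hs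
  set N : ℝ := ∑ b, ‖(u - v) b‖ ^ 2 with hN
  -- `N` is the squared length of `u - v`, the mirror direction. The realness of the inner product
  -- gives this value, and with it the reflection sends `u` to `u - (u - v)`. The case `u = v`,
  -- where no direction exists, is the empty list above.
  have hN1 : (N : ℂ) = 2 - 2 * s := by
    rw [hN, ← dotProduct_star_eq, star_sub, sub_dotProduct, dotProduct_sub, dotProduct_sub, hu, hv,
      ← huv]
    ring
  have hNpos : 0 < N := by
    obtain ⟨b, hb⟩ := Function.ne_iff.1 h
    refine Finset.sum_pos' (fun b _ => sq_nonneg _) ⟨b, Finset.mem_univ b, ?_⟩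
    have : (u - v) b ≠ 0 := sub_ne_zero.2 hb
    positivity
  set r : ℂ := ((1 / Real.sqrt N : ℝ) : ℂ) with hr
  have hr2 : r * r * N = 1 := by
    rw [hr, ← Complex.ofReal_mul, ← Complex.ofReal_mul, div_mul_div_comm, one_mul,
      Real.mul_self_sqrt hNpos.le, one_div_mul_cancel hNpos.ne', Complex.ofReal_one]
  have hrstar : star r = r := Complex.conj_ofReal _
  have hdot : ∀ x, star (r • (u - v)) ⬝ᵥ x = r * (star u ⬝ᵥ x - star v ⬝ᵥ x) := by
    intro x
    rw [star_smul, smul_dotProduct, star_sub, sub_dotProduct, hrstar, smul_eq_mul]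
  have hunit : star (r • (u - v)) ⬝ᵥ (r • (u - v)) = 1 := by
    rw [hdot, dotProduct_smul, dotProduct_smul, dotProduct_sub, dotProduct_sub, hu, hv, ← huv,
      ← hs, smul_eq_mul, smul_eq_mul]
    rw [hN1] at hr2
    linear_combination hr2
  have hswap : reflectionMatrix (r • (u - v)) *ᵥ u = v := by
    rw [reflectionMatrix_mulVec, hdot, hu, ← huv, smul_smul,
      show 2 * (r * (1 - s)) * r = 1 by rw [hN1] at hr2; linear_combination hr2, one_smul,
      sub_sub_cancel]
  refine ⟨[r • (u - v)], by simp, ?_, by simpa using hswap, ?_, ?_⟩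
  · intro w hw
    rw [List.mem_singleton] at hw
    subst hw
    exact ⟨hunit, fun b h1 h2 => by simp [h1, h2]⟩
  · simp only [List.map_cons, List.map_nil, List.prod_cons, List.prod_nil, mul_one]
    rw [← hswap, Matrix.mulVec_mulVec, hswap, reflectionMatrix_mul_self hunit, Matrix.one_mulVec]
  · intro x h1 h2
    simp only [List.map_cons, List.map_nil, List.prod_cons, List.prod_nil, mul_one]
    rw [reflectionMatrix_mulVec, hdot, h1, h2]
    simp

/-- A column can be reflected onto a multiple of its basis vector only if their inner product is
real; `ζ = z / |z|` rotates it so. -/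
lemma exists_phase (z : ℂ) : ∃ ζ : ℂ, star ζ * ζ = 1 ∧ star z * ζ = star ζ * z := by
  by_cases hz : z = 0
  · exact ⟨1, by simp, by simp [hz]⟩
  · have hn : (‖z‖ : ℂ) ≠ 0 := by simpa using hz
    have h1 : star z * z = (‖z‖ : ℂ) ^ 2 := by
      rw [Complex.star_def, ← Complex.normSq_eq_conj_mul_self, Complex.normSq_eq_norm_sq]
      push_cast; rfl
    have h2 : star (z / ‖z‖) = star z / ‖z‖ := by
      rw [star_div₀]; congr 1; exact Complex.conj_ofReal _
    refine ⟨z / ‖z‖, ?_, ?_⟩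
    · rw [h2, div_mul_div_comm, h1]
      field_simp
    · rw [h2]; ring

/-- Columns of a unitary matrix are reduced one by one with reflections. The basis vector `f`
serves to absorb phases. -/
lemma exists_reflections_reduce (hα : 4 ≤ Fintype.card α) {f p : α} (hfp : p ≠ f) (m : ℕ) :
    ∀ (U : Matrix α α ℂ) (S : Finset α) (ζ : ℂ), Uᴴ * U = 1 → f ∉ S → p ∈ S →
      S.card + 1 + m = Fintype.card α →
      (∀ b ∈ S, U *ᵥ Pi.single b 1 = Pi.single b 1) →
      star ζ * ζ = 1 → U *ᵥ Pi.single f 1 = ζ • Pi.single f 1 →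
      ∃ L : List (α → ℂ), L.length ≤ 3 * m ∧
        (∀ v ∈ L, star v ⬝ᵥ v = 1 ∧ ∃ p q, p ≠ q ∧ v p = 0 ∧ v q = 0) ∧
        ∀ b, b ≠ f → ((L.map reflectionMatrix).prod * U) *ᵥ Pi.single b 1 = Pi.single b 1 := by
  induction m with
  | zero =>
    intro U S ζ _ hfS _ hcard hS _ _
    refine ⟨[], by simp, by simp, fun b hb => ?_⟩
    have : insert f S = Finset.univ := by
      rw [← Finset.card_eq_iff_eq_univ, Finset.card_insert_of_notMem hfS, ← hcard]
    have hbS : b ∈ insert f S := this ▸ Finset.mem_univ b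
    rw [Finset.mem_insert] at hbS
    simpa using hS b (hbS.resolve_left hb)
  | succ m ih =>
    intro U S ζ hU hfS hpS hcard hS hζ hf
    obtain ⟨j, hj⟩ : ∃ j, j ∉ insert f S := by
      by_contra! h
      have := Finset.card_le_card (show Finset.univ ⊆ insert f S from fun x _ => h x)
      rw [Finset.card_insert_of_notMem hfS, Finset.card_univ] at this
      omega
    rw [Finset.mem_insert, not_or] at hj
    obtain ⟨hjf, hjS⟩ := hj
    have hpj : p ≠ j := by rintro rfl; exact hjS hpS
    have hsing : ∀ a b : α, star (Pi.single a 1 : α → ℂ) ⬝ᵥ Pi.single b 1 =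
        if a = b then 1 else 0 := by
      intro a b
      rw [← Pi.single_star, star_one, single_dotProduct, one_mul, Pi.single_apply]
    have hinner : ∀ x y : α → ℂ, star (U *ᵥ x) ⬝ᵥ (U *ᵥ y) = star x ⬝ᵥ y := by
      intro x y
      rw [Matrix.star_mulVec, Matrix.dotProduct_mulVec, Matrix.vecMul_vecMul, hU,
        Matrix.vecMul_one]
    set u : α → ℂ := U *ᵥ Pi.single j 1 with hu_def
    have hu : star u ⬝ᵥ u = 1 := by rw [hu_def, hinner, hsing, if_pos rfl]
    have huS : ∀ b ∈ S, star u ⬝ᵥ Pi.single b 1 = 0 := by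
      intro b hb
      rw [hu_def, ← hS b hb, hinner, hsing, if_neg]
      rintro rfl; exact hjS hb
    have huf : star u ⬝ᵥ Pi.single f 1 = 0 := by
      have h : star u ⬝ᵥ (U *ᵥ Pi.single f 1) = 0 := by rw [hu_def, hinner, hsing, if_neg hjf]
      rw [hf, dotProduct_smul, smul_eq_mul] at h
      refine (mul_eq_zero.1 h).resolve_left ?_
      rintro rfl
      simp at hζ
    have hentry : ∀ b, star u ⬝ᵥ Pi.single b 1 = 0 → u b = 0 := by
      intro b hb
      simpa using hb
    obtain ⟨η, hη, hη'⟩ := exists_phase (u j)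
    have hηj : star (η • Pi.single j 1 : α → ℂ) ⬝ᵥ (η • Pi.single j 1) = 1 := by
      rw [star_smul, smul_dotProduct, dotProduct_smul, hsing, if_pos rfl]
      simpa using hη
    have hdotη : ∀ b, b ≠ j → star (η • Pi.single j 1 : α → ℂ) ⬝ᵥ Pi.single b 1 = 0 := by
      intro b hb
      rw [star_smul, smul_dotProduct, hsing, if_neg hb.symm, smul_zero]
    have hdotη' : ∀ b, b ≠ j → star (Pi.single b 1 : α → ℂ) ⬝ᵥ (η • Pi.single j 1) = 0 := by
      intro b hb
      rw [dotProduct_smul, hsing, if_neg hb, smul_zero]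
    -- With `e` for basis vectors, three swaps follow: `u` with `η e_j`, then `η e_j` with `e_f`,
    -- then `e_f` with `e_j`. Together they send the column `u` to `e_j` and `e_f` to `η e_f`, so
    -- the phase ends up at `f`.
    obtain ⟨L₁, hl₁, hL₁, hu₁, -, hx₁⟩ := exists_reflection_swap hu hηj (by
      rw [dotProduct_smul, star_smul, smul_dotProduct]
      simp only [smul_eq_mul]
      rw [← Pi.single_star, star_one, single_dotProduct, dotProduct_single, Pi.star_apply]
      rw [mul_one, one_mul, ← hη']
      ring)
    obtain ⟨L₂, hl₂, hL₂, hu₂, hv₂, hx₂⟩ := exists_reflection_swap hηj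
      (show star (Pi.single f 1 : α → ℂ) ⬝ᵥ Pi.single f 1 = 1 by rw [hsing, if_pos rfl])
      (by rw [hdotη f (Ne.symm hjf), hdotη' f (Ne.symm hjf)])
    obtain ⟨L₃, hl₃, hL₃, hu₃, hv₃, hx₃⟩ := exists_reflection_swap
      (show star (Pi.single f 1 : α → ℂ) ⬝ᵥ Pi.single f 1 = 1 by rw [hsing, if_pos rfl])
      (show star (Pi.single j 1 : α → ℂ) ⬝ᵥ Pi.single j 1 = 1 by rw [hsing, if_pos rfl])
      (by rw [hsing, hsing, if_neg (Ne.symm hjf), if_neg hjf])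
    -- The last two mirror vectors live on `f` and `j`, so they vanish at `p` and `q`; four basis
    -- states are needed for `q` to exist. The first one vanishes at `p` and `f`, because `u` is
    -- orthogonal to the columns already reduced.
    obtain ⟨q, hq⟩ : ∃ q, q ∉ ({p, f, j} : Finset α) := by
      by_contra! h
      have h1 := Finset.card_le_card (show Finset.univ ⊆ ({p, f, j} : Finset α) from fun x _ => h x)
      have h2 := Finset.card_le_three (a := p) (b := f) (c := j)
      rw [Finset.card_univ] at h1
      omega
    simp only [Finset.mem_insert, Finset.mem_singleton, not_or] at hq
    obtain ⟨hqp, hqf, hqj⟩ := hq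
    set R₁ := (L₁.map reflectionMatrix).prod with hR₁
    set R₂ := (L₂.map reflectionMatrix).prod with hR₂
    set R₃ := (L₃.map reflectionMatrix).prod with hR₃
    have hprod : ((L₃ ++ L₂ ++ L₁).map reflectionMatrix).prod = R₃ * R₂ * R₁ := by
      rw [List.map_append, List.map_append, List.prod_append, List.prod_append]
    have hall : ∀ v ∈ L₃ ++ L₂ ++ L₁, star v ⬝ᵥ v = 1 ∧ ∃ p q, p ≠ q ∧ v p = 0 ∧ v q = 0 := by
      intro v hv
      rw [List.mem_append, List.mem_append] at hv
      rcases hv with (hv | hv) | hv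
      · refine ⟨(hL₃ v hv).1, p, q, Ne.symm hqp, (hL₃ v hv).2 p ?_ ?_, (hL₃ v hv).2 q ?_ ?_⟩ <;>
          simp [*]
      · refine ⟨(hL₂ v hv).1, p, q, Ne.symm hqp, (hL₂ v hv).2 p ?_ ?_, (hL₂ v hv).2 q ?_ ?_⟩ <;>
          simp [*]
      · refine ⟨(hL₁ v hv).1, p, f, hfp, (hL₁ v hv).2 p (hentry p (huS p hpS)) ?_,
          (hL₁ v hv).2 f (hentry f huf) ?_⟩
        · simp [hpj]
        · simp [Ne.symm hjf]
    have hRU := prod_reflectionMatrix_conjTranspose_mul (L₃ ++ L₂ ++ L₁) fun v hv => (hall v hv).1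
    rw [hprod] at hRU
    obtain ⟨L, hl, hL, hLU⟩ := ih (R₃ * R₂ * R₁ * U) (insert j S) (ζ * η)
      (by rw [Matrix.conjTranspose_mul, Matrix.mul_assoc, ← Matrix.mul_assoc _ _ U, hRU,
            Matrix.one_mul, hU])
      (by rw [Finset.mem_insert, not_or]; exact ⟨Ne.symm hjf, hfS⟩)
      (Finset.mem_insert_of_mem hpS)
      (by rw [Finset.card_insert_of_notMem hjS]; omega)
      (by
        intro b hb
        simp only [← Matrix.mulVec_mulVec]
        rcases Finset.mem_insert.1 hb with rfl | hbS
        · rw [← hu_def, hu₁, hu₂, hu₃]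
        · have hbj : b ≠ j := by rintro rfl; exact hjS hbS
          have hbf : b ≠ f := by rintro rfl; exact hfS hbS
          rw [hS b hbS, hx₁ _ (huS b hbS) (hdotη b hbj),
            hx₂ _ (hdotη b hbj) (by rw [hsing, if_neg hbf.symm]),
            hx₃ _ (by rw [hsing, if_neg hbf.symm]) (by rw [hsing, if_neg hbj.symm])])
      (by rw [star_mul', mul_mul_mul_comm, hζ, hη, mul_one])
      (by
        simp only [← Matrix.mulVec_mulVec]
        rw [hf, Matrix.mulVec_smul, hx₁ _ huf (hdotη f (Ne.symm hjf)), Matrix.mulVec_smul, hv₂,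
          Matrix.mulVec_smul, Matrix.mulVec_smul, hv₃, smul_smul])
    refine ⟨L ++ (L₃ ++ L₂ ++ L₁), ?_, ?_, ?_⟩
    · simp only [List.length_append]; omega
    · intro v hv
      rcases List.mem_append.1 hv with hv | hv
      · exact hL v hv
      · exact hall v hv
    · intro b hb
      rw [List.map_append, List.prod_append, hprod, Matrix.mul_assoc]
      exact hLU b hb

end ReflectionDecomposition

/-! ### The concrete register: data qubits and two ancillae. -/

section Register
variable (n : ℕ)

/-- The second ancilla. -/
abbrev lastAncilla : Fin n ⊕ Fin 2 := Sum.inr 1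

/-- The state of all wires but the last ancilla, given by the data qubits and the bit of the first
ancilla. -/
def dataState (i : Fin 2) (y : BasisState (Fin n)) :
    BasisState {w : Fin n ⊕ Fin 2 // w ≠ lastAncilla n} :=
  fun w => Sum.elim y (fun _ => i) w.1

/-- The data qubits of a state. -/
def dataBits (x : BasisState {w : Fin n ⊕ Fin 2 // w ≠ lastAncilla n}) : BasisState (Fin n) :=
  fun j => x ⟨Sum.inl j, by simp⟩

/-- The bit of the first ancilla. -/
def ancillaBit (x : BasisState {w : Fin n ⊕ Fin 2 // w ≠ lastAncilla n}) : Fin 2 :=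
  x ⟨Sum.inr 0, by simp⟩

lemma dataState_eta (x : BasisState {w : Fin n ⊕ Fin 2 // w ≠ lastAncilla n}) :
    dataState n (ancillaBit n x) (dataBits n x) = x := by
  ext ⟨w, hw⟩ : 1
  rcases w with j | j
  · rfl
  · obtain rfl : j = 0 := by
      have : j ≠ 1 := fun h => hw (by rw [h])
      revert this; revert j; simp [Fin.forall_fin_two]
    rfl

/-- The splitting of the basis states according to the bit of the first ancilla. -/
def splitAncilla : BasisState {w : Fin n ⊕ Fin 2 // w ≠ lastAncilla n} ≃
    BasisState (Fin n) ⊕ BasisState (Fin n) where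
  toFun x := if ancillaBit n x = 0 then Sum.inl (dataBits n x) else Sum.inr (dataBits n x)
  invFun := Sum.elim (dataState n 0) (dataState n 1)
  left_inv x := by
    have h := dataState_eta n x
    rcases (show ∀ a : Fin 2, a = 0 ∨ a = 1 by decide) (ancillaBit n x) with h0 | h0 <;>
      rw [h0] at h <;> simp [h0, h]
  right_inv x := by
    rcases x with y | y
    · exact if_pos rfl
    · exact if_neg one_ne_zero

lemma splitAncilla_zero (y : BasisState (Fin n)) :
    splitAncilla n (dataState n 0 y) = Sum.inl y := (splitAncilla n).apply_symm_apply (Sum.inl y)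

lemma splitAncilla_one (y : BasisState (Fin n)) :
    splitAncilla n (dataState n 1 y) = Sum.inr y := (splitAncilla n).apply_symm_apply (Sum.inr y)

lemma dataState_injective (i : Fin 2) : Function.Injective (dataState n i) :=
  Function.LeftInverse.injective (g := dataBits n) fun _ => rfl

lemma extendZero_dataState (y : BasisState (Fin n)) :
    extendZero (lastAncilla n) (dataState n 0 y) = Sum.elim y fun _ => 0 := by
  symm
  rw [eq_extendZero_iff]
  exact ⟨rfl, rfl⟩

variable {n}

/-- `U` on the data qubits, controlled by the first ancilla being `0`. -/
def extendUnitary (U : Matrix (BasisState (Fin n)) (BasisState (Fin n)) ℂ) :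
    Matrix (BasisState {w : Fin n ⊕ Fin 2 // w ≠ lastAncilla n})
      (BasisState {w : Fin n ⊕ Fin 2 // w ≠ lastAncilla n}) ℂ :=
  (Matrix.fromBlocks U 0 0 1).submatrix (splitAncilla n) (splitAncilla n)

lemma extendUnitary_conjTranspose_mul {U : Matrix (BasisState (Fin n)) (BasisState (Fin n)) ℂ}
    (hU : Uᴴ * U = 1) : (extendUnitary U)ᴴ * extendUnitary U = 1 := by
  rw [extendUnitary, Matrix.conjTranspose_submatrix, Matrix.submatrix_mul_equiv,
    Matrix.fromBlocks_conjTranspose, Matrix.fromBlocks_multiply]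
  simp [hU]

/-- These columns need no reduction. They leave only `2 ^ n` columns to clear and contain the states
`f` and `p` of the Householder reduction. -/
lemma extendUnitary_single_one (U : Matrix (BasisState (Fin n)) (BasisState (Fin n)) ℂ)
    (y : BasisState (Fin n)) :
    extendUnitary U *ᵥ Pi.single (dataState n 1 y) 1 = Pi.single (dataState n 1 y) 1 := by
  ext x
  rw [Matrix.mulVec_single_one, Matrix.col_apply, extendUnitary, Matrix.submatrix_apply,
    splitAncilla_one, Pi.single_apply]
  obtain ⟨z, rfl⟩ := (splitAncilla n).symm.surjective x
  have h : (splitAncilla n).symm z = dataState n 1 y ↔ z = Sum.inr y := by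
    rw [Equiv.symm_apply_eq, splitAncilla_one]
  rw [Equiv.apply_symm_apply, if_congr h rfl rfl]
  rcases z with z | z
  · simp
  · simp [Matrix.one_apply]

lemma addAncillae_mul_apply (U : Matrix (BasisState (Fin n)) (BasisState (Fin n)) ℂ)
    (x : BasisState (Fin n ⊕ Fin 2)) (y : BasisState (Fin n)) :
    (addAncillae n 2 * U) x y =
      (cleanWire (lastAncilla n) * extendUnitary U) x (dataState n 0 y) := by
  have h : addAncillae n 2 = (cleanWire (lastAncilla n)).submatrix id (dataState n 0) := by
    ext x y
    simp only [addAncillae, cleanWire, Matrix.submatrix_apply, Matrix.of_apply, id,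
      extendZero_dataState]
  rw [h, Matrix.mul_apply, Matrix.mul_apply, ← (splitAncilla n).symm.sum_comp, Fintype.sum_sum_type]
  simp only [extendUnitary, Matrix.submatrix_apply, Equiv.apply_symm_apply, splitAncilla_zero,
    Matrix.fromBlocks_apply₁₁, Matrix.fromBlocks_apply₂₁, Matrix.zero_apply, mul_zero,
    Finset.sum_const_zero, add_zero]
  rfl

lemma mul_addAncillae_apply (A : Matrix (BasisState (Fin n ⊕ Fin 2)) (BasisState (Fin n ⊕ Fin 2)) ℂ)
    (x : BasisState (Fin n ⊕ Fin 2)) (y : BasisState (Fin n)) :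
    (A * addAncillae n 2) x y = (A * cleanWire (lastAncilla n)) x (dataState n 0 y) := by
  rw [mul_cleanWire, extendZero_dataState]
  simp [addAncillae, Matrix.mul_apply]

end Register

lemma frobeniusDist_submatrix_le {l m k : Type} [Fintype l] [Fintype m] [Fintype k] {s : k → m}
    (hs : Function.Injective s) (A B : Matrix l m ℂ) :
    frobeniusDist (A.submatrix id s) (B.submatrix id s) ≤ frobeniusDist A B := by
  rw [frobeniusDist_eq, frobeniusDist_eq]
  refine Real.sqrt_le_sqrt (Finset.sum_le_sum fun i _ => ?_)
  have := Finset.sum_le_univ_sum_of_nonneg (s := Finset.univ.map ⟨s, hs⟩)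
    (f := fun j => ‖A i j - B i j‖ ^ 2) fun j => sq_nonneg _
  rw [Finset.sum_map] at this
  exact this

/-- Every unitary operator on the data qubits is realized, up to the error in the rounding of the
reflections, by a circuit with two ancillae. -/
lemma exists_circuit_of_unitary {n : ℕ} (hn : 1 ≤ n)
    {U : Matrix (BasisState (Fin n)) (BasisState (Fin n)) ℂ} (hU : Uᴴ * U = 1) (K : ℕ) :
    ∃ C : CliffordTCircuit (Fin n ⊕ Fin 2),
      C.length ≤ 3 * 2 ^ n * ((16 * K + 1) * (2 * 2 ^ n * (81700 * (n + 2)))) ∧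
      ApproximatesWithin C U (3 * 2 ^ n * (4 * Real.sqrt (12 * 2 ^ n / 2 ^ K))) := by
  have hB : Fintype.card (BasisState (Fin n)) = 2 ^ n := by simp
  have hβ : Fintype.card (BasisState {w : Fin n ⊕ Fin 2 // w ≠ lastAncilla n}) = 2 * 2 ^ n := by
    rw [Fintype.card_congr (splitAncilla n), Fintype.card_sum, hB, two_mul]
  have hκ : Fintype.card (Fin n ⊕ Fin 2) = n + 2 := by simp
  have h2n : 2 ≤ 2 ^ n := by
    calc 2 = 2 ^ 1 := rfl
      _ ≤ 2 ^ n := Nat.pow_le_pow_right (by norm_num) hn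
  have hfp : dataState n 1 1 ≠ dataState n 1 0 := by
    intro h
    have := congrFun (dataState_injective n 1 h) ⟨0, hn⟩
    simp at this
  -- Here `f` and `p` have first ancilla bit 1 and data bits all 0, respectively all 1; they differ
  -- because `1 ≤ n`.
  obtain ⟨L, hl, hL, hLU⟩ := exists_reflections_reduce (by rw [hβ]; omega) hfp (2 ^ n)
    (extendUnitary U) ((Finset.univ.image (dataState n 1)).erase (dataState n 1 0)) 1
    (extendUnitary_conjTranspose_mul hU) (Finset.notMem_erase _ _)
    (by simp [hfp])
    (by
      rw [Finset.card_erase_add_one (by simp),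
        Finset.card_image_of_injective _ (dataState_injective n 1), Finset.card_univ, hB, hβ,
        two_mul])
    (by
      intro b hb
      obtain ⟨y, -, rfl⟩ := Finset.mem_image.1 (Finset.mem_of_mem_erase hb)
      exact extendUnitary_single_one U y)
    (by simp) (by rw [extendUnitary_single_one, one_smul])
  set P := (L.map reflectionMatrix).prod with hP
  have hPP : Pᴴ * P = 1 := prod_reflectionMatrix_conjTranspose_mul L fun v hv => (hL v hv).1
  -- `P * extendUnitary U` may have a phase at `f`, but fixes all other basis vectors. Only columns
  -- with first ancilla bit 0 are read, and there `extendUnitary U` equals `Pᴴ`.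
  have hcol : ∀ (x) (y : BasisState (Fin n)),
      extendUnitary U x (dataState n 0 y) = Pᴴ x (dataState n 0 y) := by
    intro x y
    have h0 : dataState n 0 y ≠ dataState n 1 0 := by
      intro h
      have := congrArg (ancillaBit n) h
      exact zero_ne_one this
    have h : extendUnitary U *ᵥ Pi.single (dataState n 0 y) 1 =
        Pᴴ *ᵥ Pi.single (dataState n 0 y) 1 := by
      calc _ = (Pᴴ * P * extendUnitary U) *ᵥ Pi.single (dataState n 0 y) 1 := by
            rw [hPP, Matrix.one_mul]
        _ = Pᴴ *ᵥ ((P * extendUnitary U) *ᵥ Pi.single (dataState n 0 y) 1) := by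
            rw [Matrix.mulVec_mulVec, Matrix.mul_assoc]
        _ = _ := by rw [hLU _ h0]
    rw [Matrix.mulVec_single_one, Matrix.mulVec_single_one] at h
    exact congrFun h x
  obtain ⟨V, ⟨A, ⟨C, hC, rfl⟩, hCV⟩, hV⟩ := exists_implClean_approx_prod (c := lastAncilla n)
    (by rw [hκ]; omega) K L.reverse (fun v hv => hL v (List.mem_reverse.1 hv))
  rw [← prod_reflectionMatrix_conjTranspose, ← hP] at hV
  rw [List.length_reverse, hβ] at hC hV
  rw [hκ] at hC
  have hl' : (L.length : ℝ) ≤ 3 * 2 ^ n := by exact_mod_cast hl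
  refine ⟨C, hC.trans (Nat.mul_le_mul_right _ hl), ?_⟩
  have h1 : circuitMatrix C * addAncillae n 2 =
      (cleanWire (lastAncilla n) * V).submatrix id (dataState n 0) := by
    ext x y
    rw [mul_addAncillae_apply, hCV]
    rfl
  have h2 : addAncillae n 2 * U =
      (cleanWire (lastAncilla n) * Pᴴ).submatrix id (dataState n 0) := by
    ext x y
    rw [addAncillae_mul_apply, Matrix.submatrix_apply, cleanWire_mul, cleanWire_mul, hcol]
    rfl
  rw [ApproximatesWithin, h1, h2]
  refine (frobeniusDist_submatrix_le (dataState_injective n 0) _ _).trans ?_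
  rw [frobeniusDist_mul_left cleanWire_conjTranspose_mul]
  refine hV.trans ?_
  have h3 : (6 : ℝ) * ((2 * 2 ^ n : ℕ) : ℝ) / 2 ^ K = 12 * 2 ^ n / 2 ^ K := by
    push_cast; ring
  rw [h3]
  gcongr

theorem theorem1 :
    ∃ C : ℝ, 0 < C ∧
      ∀ (n : ℕ), 1 ≤ n →
      ∀ U ∈ Matrix.unitaryGroup (BasisState (Fin n)) ℂ,
      ∀ ε : ℝ, 0 < ε → ε ≤ 1 →
        ∃ (a : ℕ) (c : CliffordTCircuit (Fin n ⊕ Fin a)),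
          a ≤ 2 ∧
          (c.length : ℝ) ≤ C * ((4 : ℝ) ^ n * (n : ℝ) * (Real.log (1 / ε) + (n : ℝ))) ∧
          ApproximatesWithin c U ε := by
  -- `1470600 = 3 * 2 * 81700 * 3`, the last 3 from `n + 2 ≤ 3 * n`; `257 = 16 * 11 + 1 + 32 + 48`
  -- bounds the number of rounds.
  refine ⟨1470600 * 257, by norm_num, fun n hn U hU ε hε hε1 => ?_⟩
  have hn' : (1 : ℝ) ≤ n := by exact_mod_cast hn
  have hlog : 0 ≤ Real.log (1 / ε) := Real.log_nonneg (by rw [le_div_iff₀ hε]; linarith)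
  -- The factor 2 suffices for `1 / ε ≤ 2 ^ q` because `log 2 > 1 / 2`.
  set q : ℕ := ⌈2 * Real.log (1 / ε)⌉₊ with hq
  have hq1 : (q : ℝ) ≤ 2 * Real.log (1 / ε) + 1 := (Nat.ceil_lt_add_one (by positivity)).le
  have hq2 : 1 / ε ≤ 2 ^ q := by
    rw [← Real.log_le_log_iff (by positivity) (by positivity), Real.log_pow]
    have h1 := Nat.le_ceil (2 * Real.log (1 / ε))
    have h2 := Real.log_two_gt_d9
    nlinarith
  -- The error is at most `ε` once `12 ^ 3 * 2 ^ (3 * n) / ε ^ 2 ≤ 2 ^ K`; the three summands of `K`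
  -- cover `12 ^ 3 ≤ 2 ^ 11`, `2 ^ (3 * n)` and `1 / ε ^ 2 ≤ 2 ^ (2 * q)`.
  obtain ⟨C, hC, hCU⟩ := exists_circuit_of_unitary hn (Matrix.mem_unitaryGroup_iff'.1 hU)
    (11 + 3 * n + 2 * q)
  refine ⟨2, C, le_rfl, ?_, hCU.trans ?_⟩
  · have hC' : (C.length : ℝ) ≤ 3 * 2 ^ n * ((16 * (11 + 3 * n + 2 * q) + 1) *
        (2 * 2 ^ n * (81700 * (n + 2)))) := by exact_mod_cast hC
    refine hC'.trans ?_
    have h4 : (4 : ℝ) ^ n = 2 ^ n * 2 ^ n := by rw [← mul_pow]; norm_num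
    rw [h4]
    have h5 : (16 * (11 + 3 * (n : ℝ) + 2 * q) + 1) ≤ 257 * (Real.log (1 / ε) + n) := by linarith
    have h6 : (n : ℝ) + 2 ≤ 3 * n := by linarith
    calc _ = 490200 * (2 ^ n * 2 ^ n) *
          ((16 * (11 + 3 * (n : ℝ) + 2 * q) + 1) * ((n : ℝ) + 2)) := by ring
      _ ≤ 490200 * (2 ^ n * 2 ^ n) * ((257 * (Real.log (1 / ε) + n)) * (3 * n)) := by gcongr
      _ = _ := by ring
  · have h1 : Real.sqrt (12 * 2 ^ n / 2 ^ (11 + 3 * n + 2 * q)) ≤ ε / (12 * 2 ^ n) := by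
      refine Real.sqrt_le_iff.2 ⟨by positivity, ?_⟩
      have h2 : 1 ≤ (2 : ℝ) ^ q * ε := by rwa [← div_le_iff₀ hε]
      have h3 : 1 ≤ ((2 : ℝ) ^ q * ε) ^ 2 := one_le_pow₀ h2
      rw [div_pow, div_le_div_iff₀ (by positivity) (by positivity), pow_add, pow_add, pow_mul',
        pow_mul']
      have h4 : (0 : ℝ) < (2 ^ n) ^ 3 := by positivity
      nlinarith
    calc _ = 12 * 2 ^ n * Real.sqrt (12 * 2 ^ n / 2 ^ (11 + 3 * n + 2 * q)) := by ring
      _ ≤ 12 * 2 ^ n * (ε / (12 * 2 ^ n)) := by gcongr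
      _ = ε := by field_simp
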